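/- \textbf{Conventions.} An interval greedoid $(E,\mathcal F)$ is a finite set $E$ with a nonempty family $\mathcal F$ of subsets (feasible sets) such that for $X,Y,Z\in\mathcal F$: (IG1) if $X\ne\emptyset$, then $X\setminus x\in\mathcal F$ for some $x\in X$; (IG2) if $|X|>|Y|$, then $Y\cup x\in\mathcal F$ for some $x\in X\setminus Y$; (IG3) if $X\subseteq Y\subseteq Z$, $e\in E\setminus Z$, $X\cup e\in\mathcal F$ and $Z\cup e\in\mathcal F$, then $Y\cup e\in\mathcal F$. For $X\in\mathcal F$ let $\mathcal F/X=\{Y\subseteq E\setminus X: X\cup Y\in\mathcal F\}$, and let $X\sim Y$ iff $\mathcal F/X=\mathcal F/Y$. The classes $[X]$ are the flats; they form a lattice $\Phi$ with $[X]\le[Y]$ iff $Y\cup Z\sim X$ for some $Z\in\mathcal F/Y$. For a flat $A=[X]$ let $\Gamma(A)=\{e\in E\setminus X: X\cup e\in\mathcal F\}$ and $\xi(A)=\bigcup_{X'\sim X}X'$. A covector with support $A\in\Phi$ is a map $\alpha:E\to\{0,+,-,1\}$ with values in $\{+,-\}$ on $\Gamma(A)$, $0$ on $\xi(A)$ and $1$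 elsewhere. Let $\alpha\le\beta$ iff $\operatorname{supp}\alpha\le\operatorname{supp}\beta$ and $\alpha,\beta$ agree on $\Gamma(\operatorname{supp}\alpha)\cap\Gamma(\operatorname{supp}\beta)$. The product $\alpha\circ\beta$ is the covector with support $\operatorname{supp}\alpha\vee\operatorname{supp}\beta=C$ that equals $\alpha$ on $\Gamma(C)\cap\Gamma(\operatorname{supp}\alpha)$ and $\beta$ on the rest of $\Gamma(C)$; $-\alpha$ exchanges $+$ and $-$; and $S(\alpha,\beta)=\{e:\alpha(e)=-\beta(e)\in\{+,-\}\}$. An oriented interval greedoid $(E,\mathcal F,\mathcal L)$ is an interval greedoid with a set $\mathcal L$ of covectors such that (OG1) $\operatorname{supp}:\mathcal L\to\Phi$ is surjective; (OG2) $-\alpha\in\mathcal L$ for $\alpha\in\mathcal L$; (OG3) $\alpha\circ\beta\in\mathcal L$ for $\alpha,\beta\in\mathcal L$; (OG4) if $\alpha,\beta\in\mathcal L$, $x\in S(\alpha,\beta)$ and $(\alpha\circ\beta)(x)\neq1$, there is $\gamma\in\mathcal L$ with $\gamma(x)=0$ and $\gamma(y)=(\alpha\circ\beta)(y)=(\beta\circ\alpha)(y)$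 for all $y\notin S(\alpha,\beta)$ with $(\alpha\circ\beta)(y)\ne1$. Let $\hat{\mathcal L}$ be $\mathcal L$ with a new maximum $\hat1$ adjoined, and let $\bot$ be the least element of $\mathcal L$. The contraction $\mathcal L/X$ by $X\in\mathcal F$ consists of the covectors $\operatorname{con}_X(\alpha)$ of $\mathcal F/X$ for $\alpha\in\mathcal L$ with $\operatorname{supp}\alpha=[X\cup Y]$, $Y\in\mathcal F/X$; here $\operatorname{con}_X(\alpha)$ is supported by the flat of $Y$ in $\mathcal F/X$ and agrees with $\alpha$ on the continuations of that flat; it depends only on the flat $[X]$ and $\alpha$. A tope is a maximal element of $\mathcal L$, and a facet of a tope is an element of $\mathcal L$ covered by it. For a tope $\alpha$, the tope poset $\mathcal T(\mathcal L,\alpha)$ is the set of topes with $\beta\le\beta'$ iff $S(\alpha,\beta)\subseteq S(\alpha,\beta')$. A linear order $q_1,\dots,q_n$ on the coatoms of a bounded graded poset $P$ is a recursive coatom ordering if, for each $i$: (i) $[\hat0,q_i]$ has a recursive coatom ordering in which the coatoms of $[\hat0,q_i]$ lying below some $q_j$ with $j<i$ come first; and (ii) any element lying below $q_i$ and below some $q_j$,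 $j<i$, lies below a coatom of $[\hat0,q_i]$ that lies below some $q_k$ with $k<i$. (For $P$ of rank at most $1$ the only order of the coatoms is one.) Let $\alpha$ be a tope and $\overline\beta:\ \alpha=\beta_0<\dots<\beta_r=-\alpha$ a maximal chain in $\mathcal T(\mathcal L,\alpha)$. For each $i$ choose a common facet $\gamma_i$ of $\beta_{i-1}$ and $\beta_i$, and let $G_i=\operatorname{supp}\gamma_i$; the $G_i$ are distinct and are exactly the coatoms of $\Phi$. Let $\mathcal L_i$ be the contraction of $\mathcal L$ to $G_i$; its topes are identified with the elements of $\mathcal L$ with support $G_i$. A linear extension of $\mathcal T(\mathcal L_i,\gamma_i)$ is adapted to $\alpha$ if it lists first the topes of $\mathcal L_i$ that for some $j<i$ lie on the same side of $G_j$ as $\gamma_i$ (have the same sign as $\gamma_i$ at an $x$ with $\{x\}\in\mathcal F$, $[\{x\}]=G_j$), then those that are facets of $\alpha$, then all others. A linear order on the facets of $\alpha$ (the coatoms of $[\bot,\alpha]$) is compatible with $\overline\beta$ if, for some choice of the $\gamma_i$, the facets are arranged by increasing index $i$ of their support $G_i$, and for each $i$ those with support $G_i$ are arranged according to a linear extension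 of $\mathcal T(\mathcal L_i,\gamma_i)$ adapted to $\alpha$. \textbf{Statement.} Let $(E,\mathcal F,\mathcal L)$ be an oriented interval greedoid. Then $\hat{\mathcal L}$ (a bounded graded poset) admits a recursive coatom ordering. More precisely: \begin{enumerate} \item For every tope $\alpha$ of $\mathcal L$ and every maximal chain $\overline\beta$ in $\mathcal T(\mathcal L,\alpha)$, any order on the coatoms of $[\bot,\alpha]$ compatible with $\overline\beta$ is a recursive coatom ordering of $[\bot,\alpha]$. \item For every tope $\alpha$ of $\mathcal L$, any linear extension of $\mathcal T(\mathcal L,\alpha)$ is a recursive coatom ordering of $\hat{\mathcal L}$. \end{enumerate} -/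

import Mathlib

/-! ### Interval greedoids and their flats -/

/-- An interval greedoid on the ground set `E`: a nonempty family of (feasible) finite subsets
of `E` subject to the three axioms (IG1), (IG2), (IG3). -/
structure IntervalGreedoid (E : Type*) [DecidableEq E] where
  Feasible : Finset E → Prop
  exists_feasible : ∃ X, Feasible X
  ig1 : ∀ X, Feasible X → X ≠ ∅ → ∃ x ∈ X, Feasible (X.erase x)
  ig2 : ∀ X Y, Feasible X → Feasible Y → Y.card < X.card →
    ∃ x ∈ X \ Y, Feasible (insert x Y)
  ig3 : ∀ X Y Z, Feasible X → Feasible Y → Feasible Z → X ⊆ Y → Y ⊆ Z →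
    ∀ e, e ∉ Z → Feasible (insert e X) → Feasible (insert e Z) → Feasible (insert e Y)

namespace IntervalGreedoid

variable {E : Type*} [DecidableEq E]

/-- The feasible sets as a type. -/
abbrev FeasibleSet (G : IntervalGreedoid E) := {X : Finset E // G.Feasible X}

/-- `G.quot X` is the family `F/X` of sets disjoint from `X` that can be added to `X`
preserving feasibility. -/
def quot (G : IntervalGreedoid E) (X : Finset E) : Set (Finset E) :=
  {Y | Disjoint X Y ∧ G.Feasible (X ∪ Y)}

lemma quot_union (G : IntervalGreedoid E) {X Y Z : Finset E} (hZ : Z ∈ G.quot X)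
    (h : G.quot X = G.quot Y) : G.quot (X ∪ Z) = G.quot (Y ∪ Z) := by
  have hZ' : Z ∈ G.quot Y := h ▸ hZ
  have key : ∀ {A B : Finset E}, Z ∈ G.quot A → Z ∈ G.quot B → G.quot A = G.quot B →
      G.quot (A ∪ Z) ⊆ G.quot (B ∪ Z) := by
    intro A B hA hB hAB W hW
    obtain ⟨hd, hf⟩ := hW
    rw [Finset.disjoint_union_left] at hd
    have hm : Z ∪ W ∈ G.quot A := by
      refine ⟨Finset.disjoint_union_right.2 ⟨hA.1, hd.1⟩, ?_⟩
      rwa [← Finset.union_assoc]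
    rw [hAB] at hm
    refine ⟨Finset.disjoint_union_left.2 ⟨(Finset.disjoint_union_right.1 hm.1).2, hd.2⟩, ?_⟩
    rw [Finset.union_assoc]
    exact hm.2
  exact Set.Subset.antisymm (key hZ hZ' h) (key hZ' hZ h.symm)

/-- Two feasible sets are equivalent if they have the same quotient family. -/
instance flatSetoid (G : IntervalGreedoid E) : Setoid G.FeasibleSet where
  r X Y := G.quot X.1 = G.quot Y.1
  iseqv := ⟨fun _ => rfl, fun h => h.symm, fun h k => h.trans k⟩

/-- The flats are the equivalence classes of feasible sets. -/
def Flat (G : IntervalGreedoid E) := Quotient G.flatSetoid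

/-- The flat `[X]` of a feasible set `X`. -/
def flatOf (G : IntervalGreedoid E) (X : G.FeasibleSet) : G.Flat := Quotient.mk _ X

lemma flatOf_eq {G : IntervalGreedoid E} {X Y : G.FeasibleSet} :
    G.flatOf X = G.flatOf Y ↔ G.quot X.1 = G.quot Y.1 :=
  ⟨fun h => Quotient.exact h, fun h => Quotient.sound h⟩

lemma empty_feasible (G : IntervalGreedoid E) : G.Feasible ∅ := by
  obtain ⟨X, hX⟩ := G.exists_feasible
  induction hn : X.card generalizing X with
  | zero => rwa [Finset.card_eq_zero.1 hn] at hX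
  | succ n ih =>
    obtain ⟨x, hx, hf⟩ := G.ig1 X hX (by rintro rfl; simp at hn)
    exact ih _ hf (by rw [Finset.card_erase_of_mem hx, hn]; rfl)

/-- The flat `[∅]`. -/
def flatEmpty (G : IntervalGreedoid E) : G.Flat := G.flatOf ⟨∅, G.empty_feasible⟩

/-- The continuations `Γ(A)` of a flat `A = [X]`: the `e ∉ X` with `X ∪ {e}` feasible
(this does not depend on the representative `X`). -/
def cont (G : IntervalGreedoid E) (A : G.Flat) : Set E :=
  {e | ∃ X : G.FeasibleSet, G.flatOf X = A ∧ e ∉ X.1 ∧ G.Feasible (insert e X.1)}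

/-- `ξ(A)`: the union of all feasible sets in the class `A`. -/
def xi (G : IntervalGreedoid E) (A : G.Flat) : Set E :=
  {e | ∃ X : G.FeasibleSet, G.flatOf X = A ∧ e ∈ X.1}

lemma mem_cont_flatOf {G : IntervalGreedoid E} {X : G.FeasibleSet} {e : E} :
    e ∈ G.cont (G.flatOf X) ↔ e ∉ X.1 ∧ G.Feasible (insert e X.1) := by
  have key : ∀ Y : G.FeasibleSet,
      ({e} : Finset E) ∈ G.quot Y.1 ↔ e ∉ Y.1 ∧ G.Feasible (insert e Y.1) := by
    intro Y
    rw [quot, Set.mem_ofPred_eq, Finset.disjoint_singleton_right, Finset.union_comm,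
      ← Finset.insert_eq]
  constructor
  · rintro ⟨Y, hY, h⟩
    rw [← key, flatOf_eq.1 hY, key] at *
    exact h
  · exact fun h => ⟨X, rfl, h⟩

/-- The order on flats: `[X] ≤ [Y]` iff `Y ∪ Z ∼ X` for some `Z ∈ F/Y`. -/
instance (G : IntervalGreedoid E) : LE G.Flat where
  le A B := ∃ X Y : G.FeasibleSet, G.flatOf X = A ∧ G.flatOf Y = B ∧
    ∃ Z ∈ G.quot Y.1, G.quot (Y.1 ∪ Z) = G.quot X.1

lemma flat_le_iff {G : IntervalGreedoid E} {A : G.Flat} {Y : G.FeasibleSet} :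
    A ≤ G.flatOf Y ↔ ∃ (Z : Finset E) (hZ : Z ∈ G.quot Y.1), G.flatOf ⟨Y.1 ∪ Z, hZ.2⟩ = A := by
  constructor
  · rintro ⟨X, Y', rfl, hY, Z, hZ, h⟩
    have hY := flatOf_eq.1 hY
    refine ⟨Z, hY ▸ hZ, flatOf_eq.2 ?_⟩
    rw [← h]
    exact (G.quot_union hZ hY).symm
  · rintro ⟨Z, hZ, rfl⟩
    exact ⟨_, Y, rfl, rfl, Z, hZ, rfl⟩

/-- A feasible set `X` extends to a feasible set of the cardinality of any larger feasible set
`Y`, using elements of `Y` only. -/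
lemma exists_extension (G : IntervalGreedoid E) (X Y : G.FeasibleSet) (n : ℕ)
    (h1 : X.1.card ≤ n) (h2 : n ≤ Y.1.card) :
    ∃ Z ∈ G.quot X.1, Z ⊆ Y.1 ∧ (X.1 ∪ Z).card = n := by
  induction n, h1 using Nat.le_induction with
  | base => exact ⟨∅, ⟨by simp, by simpa using X.2⟩, by simp, by simp⟩
  | succ n hn ih =>
    obtain ⟨Z, hZ, hZY, hc⟩ := ih (by omega)
    obtain ⟨x, hx, hf⟩ := G.ig2 Y.1 (X.1 ∪ Z) Y.2 hZ.2 (by omega)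
    rw [Finset.mem_sdiff, Finset.mem_union, not_or] at hx
    refine ⟨insert x Z, ⟨?_, ?_⟩, ?_, ?_⟩
    · exact Finset.disjoint_insert_right.2 ⟨hx.2.1, hZ.1⟩
    · rwa [Finset.union_insert]
    · exact Finset.insert_subset hx.1 hZY
    · rw [Finset.union_insert, Finset.card_insert_of_notMem (by simpa using hx.2), hc]

lemma card_le_of_quot_eq [Finite E] (G : IntervalGreedoid E) {X Y : G.FeasibleSet}
    (h : G.quot X.1 = G.quot Y.1) : Y.1.card ≤ X.1.card := by
  have : Fintype E := Fintype.ofFinite E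
  have hfin : (Set.univ : Set G.FeasibleSet).Finite := Set.toFinite _
  obtain ⟨B, -, hB⟩ := Set.exists_max_image Set.univ (fun X : G.FeasibleSet => X.1.card) hfin
    ⟨X, trivial⟩
  obtain ⟨Z, hZ, -, hc⟩ := G.exists_extension X B B.1.card (hB X trivial) le_rfl
  have hZ' : Z ∈ G.quot Y.1 := h ▸ hZ
  have h1 := hB ⟨_, hZ'.2⟩ trivial
  simp only at h1
  rw [Finset.card_union_of_disjoint hZ'.1] at h1
  rw [Finset.card_union_of_disjoint hZ.1] at hc
  omega

instance [Finite E] (G : IntervalGreedoid E) : PartialOrder G.Flat where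
  le_refl A := by
    induction A using Quotient.inductionOn with
    | h X =>
      refine flat_le_iff.2 ⟨∅, ⟨by simp, by simpa using X.2⟩, ?_⟩
      exact flatOf_eq.2 (by simp)
  le_trans A B C hAB hBC := by
    induction C using Quotient.inductionOn with
    | h W =>
      obtain ⟨Z', hZ', rfl⟩ := flat_le_iff.1 hBC
      obtain ⟨Z, hZ, rfl⟩ := flat_le_iff.1 hAB
      have hd := Finset.disjoint_union_left.1 hZ.1
      refine flat_le_iff.2 ⟨Z' ∪ Z, ⟨Finset.disjoint_union_right.2 ⟨hZ'.1, hd.1⟩, ?_⟩, ?_⟩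
      · rw [← Finset.union_assoc]; exact hZ.2
      · exact flatOf_eq.2 (by simp only [Finset.union_assoc])
  le_antisymm A B hAB hBA := by
    induction B using Quotient.inductionOn with
    | h Y =>
      obtain ⟨Z, hZ, rfl⟩ := flat_le_iff.1 hAB
      obtain ⟨W, hW, h⟩ := flat_le_iff.1 hBA
      have h1 := G.card_le_of_quot_eq (flatOf_eq.1 h)
      simp only at h1
      have h2 := G.card_le_of_quot_eq (flatOf_eq.1 h).symm
      simp only at h2
      rw [Finset.card_union_of_disjoint hW.1, Finset.card_union_of_disjoint hZ.1] at h2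
      have hZ0 : Z = ∅ := Finset.card_eq_zero.1 (by omega)
      subst hZ0
      exact flatOf_eq.2 (by simp)

/-- The contraction by a feasible set `X`, with feasible sets `F/X`. It is kept on the same
type `E`; the elements outside of its ground set `⋃ F/X` lie in no feasible set, so that every
covector takes the value `1` there. -/
def contract (G : IntervalGreedoid E) (X : G.FeasibleSet) : IntervalGreedoid E where
  Feasible Y := Y ∈ G.quot X.1
  exists_feasible := ⟨∅, by simp, by simpa using X.2⟩
  ig1 Y hY hne := by
    have hpos : 0 < Y.card := Finset.card_pos.2 (Finset.nonempty_iff_ne_empty.2 hne)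
    have hcard := Finset.card_union_of_disjoint hY.1
    obtain ⟨Z, hZ, hZY, hc⟩ := G.exists_extension X ⟨_, hY.2⟩ (X.1.card + (Y.card - 1))
      (by omega) (by simp only; omega)
    rw [Finset.card_union_of_disjoint hZ.1] at hc
    have hsub : Z ⊆ Y := fun z hz => by
      rcases Finset.mem_union.1 (hZY hz) with h | h
      · exact absurd hz (Finset.disjoint_left.1 hZ.1 h)
      · exact h
    have h1 : (Y \ Z).card = 1 := by
      rw [Finset.card_sdiff_of_subset hsub]; omega
    obtain ⟨y, hy⟩ := Finset.card_eq_one.1 h1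
    have hyY : y ∈ Y := (Finset.mem_sdiff.1 (hy ▸ Finset.mem_singleton_self y)).1
    refine ⟨y, hyY, ?_⟩
    rw [← Finset.sdiff_singleton_eq_erase, ← hy, Finset.sdiff_sdiff_eq_self hsub]
    exact hZ
  ig2 Y Y' hY hY' h := by
    obtain ⟨x, hx, hf⟩ := G.ig2 (X.1 ∪ Y) (X.1 ∪ Y') hY.2 hY'.2 (by
      rw [Finset.card_union_of_disjoint hY.1, Finset.card_union_of_disjoint hY'.1]; omega)
    simp only [Finset.mem_sdiff, Finset.mem_union, not_or] at hx
    obtain ⟨h1, h2, h3⟩ := hx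
    refine ⟨x, Finset.mem_sdiff.2 ⟨h1.resolve_left h2, h3⟩,
      Finset.disjoint_insert_right.2 ⟨h2, hY'.1⟩, ?_⟩
    rwa [Finset.union_insert]
  ig3 A B C hA hB hC hAB hBC e he h1 h2 := by
    have heX : e ∉ X.1 := (Finset.disjoint_insert_right.1 h1.1).1
    refine ⟨Finset.disjoint_insert_right.2 ⟨heX, hB.1⟩, ?_⟩
    rw [Finset.union_insert]
    refine G.ig3 (X.1 ∪ A) (X.1 ∪ B) (X.1 ∪ C) hA.2 hB.2 hC.2
      (Finset.union_subset_union_right hAB) (Finset.union_subset_union_right hBC) e ?_ ?_ ?_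
    · simp [heX, he]
    · rw [← Finset.union_insert]; exact h1.2
    · rw [← Finset.union_insert]; exact h2.2

end IntervalGreedoid

/-! ### Covectors -/

/-- The four symbols `0, +, -, 1`. -/
inductive CovSign
  | zero | pos | neg | one

/-- Exchange `+` and `-`. -/
def CovSign.flip : CovSign → CovSign
  | .zero => .zero
  | .pos => .neg
  | .neg => .pos
  | .one => .one

namespace IntervalGreedoid

variable {E : Type*} [DecidableEq E]

/-- A covector: a map `E → {0, +, -, 1}` with values in `{+, -}` on `Γ(A)`, the value `0` on
`ξ(A)` and the value `1` elsewhere, for a flat `A`. The flat (the support of the covector) is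
determined by the map, as `ξ` is injective. -/
@[ext]
structure Covector (G : IntervalGreedoid E) where
  supp : G.Flat
  val : E → CovSign
  val_cont : ∀ e ∈ G.cont supp, val e = .pos ∨ val e = .neg
  val_xi : ∀ e ∈ G.xi supp, val e = .zero
  val_else : ∀ e, e ∉ G.cont supp → e ∉ G.xi supp → val e = .one

namespace Covector

/-- The covector `-α`. -/
instance (G : IntervalGreedoid E) : Neg G.Covector where
  neg α :=
    { supp := α.supp
      val := fun e => (α.val e).flip
      val_cont := fun e he => by
        rcases α.val_cont e he with h | h <;> simp [h, CovSign.flip]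
      val_xi := fun e he => by simp [α.val_xi e he, CovSign.flip]
      val_else := fun e h1 h2 => by simp [α.val_else e h1 h2, CovSign.flip] }

/-- The order on covectors (signed flats): `α ≤ β` iff `supp α ≤ supp β` and `α`, `β` agree on
`Γ(supp α) ∩ Γ(supp β)`. -/
instance [Finite E] (G : IntervalGreedoid E) : PartialOrder G.Covector where
  le α β := α.supp ≤ β.supp ∧ ∀ e ∈ G.cont α.supp ∩ G.cont β.supp, α.val e = β.val e
  le_refl α := ⟨le_refl _, fun _ _ => rfl⟩
  le_trans α β γ hab hbc := by
    refine ⟨hab.1.trans hbc.1, fun e he => ?_⟩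
    have hb : e ∈ G.cont β.supp := by
      obtain ⟨A, hA⟩ : ∃ A, A = α.supp := ⟨_, rfl⟩
      obtain ⟨B, hB⟩ : ∃ B, B = β.supp := ⟨_, rfl⟩
      obtain ⟨C, hC⟩ : ∃ C, C = γ.supp := ⟨_, rfl⟩
      have h1 := hab.1
      have h2 := hbc.1
      rw [← hA, ← hB] at h1
      rw [← hB, ← hC] at h2
      rw [← hA, ← hC] at he
      rw [← hB]
      obtain ⟨W, rfl⟩ : ∃ W, G.flatOf W = C := Quotient.exists_rep C
      obtain ⟨Z', hZ', rfl⟩ := flat_le_iff.1 h2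
      obtain ⟨Z, hZ, rfl⟩ := flat_le_iff.1 h1
      obtain ⟨ha, hc⟩ := he
      rw [mem_cont_flatOf] at ha hc ⊢
      have hne : e ∉ W.1 ∪ Z' := fun h => ha.1 (Finset.mem_union_left _ h)
      exact ⟨hne, G.ig3 _ _ _ W.2 hZ'.2 hZ.2 Finset.subset_union_left
        Finset.subset_union_left e ha.1 hc.2 ha.2⟩
    exact (hab.2 e ⟨he.1, hb⟩).trans (hbc.2 e ⟨hb, he.2⟩)
  le_antisymm α β hab hba := by
    have hs := le_antisymm hab.1 hba.1
    refine Covector.ext hs (funext fun e => ?_)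
    by_cases h1 : e ∈ G.cont α.supp
    · exact hab.2 e ⟨h1, hs ▸ h1⟩
    · by_cases h2 : e ∈ G.xi α.supp
      · rw [α.val_xi e h2, β.val_xi e (hs ▸ h2)]
      · rw [α.val_else e h1 h2, β.val_else e (hs ▸ h1) (hs ▸ h2)]

/-- The separation set of two covectors. -/
def sep {G : IntervalGreedoid E} (α β : G.Covector) : Set E :=
  {e | (α.val e = .pos ∧ β.val e = .neg) ∨ (α.val e = .neg ∧ β.val e = .pos)}

/-- `IsProd α β π` says that `π = α ∘ β`: the support of `π` is `supp α ∨ supp β` and, on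
`Γ(supp π)`, `π` is `α` on `Γ(supp α)` and `β` elsewhere. -/
def IsProd [Finite E] {G : IntervalGreedoid E} (α β π : G.Covector) : Prop :=
  IsLUB {α.supp, β.supp} π.supp ∧
    ∀ e ∈ G.cont π.supp, (e ∈ G.cont α.supp → π.val e = α.val e) ∧
      (e ∉ G.cont α.supp → π.val e = β.val e)

end Covector

/-- `(E, F, L)` is an oriented interval greedoid: axioms (OG1)-(OG4) for a set `L` of
covectors of the interval greedoid `G = (E, F)`. -/
structure IsOriented [Finite E] (G : IntervalGreedoid E) (L : Set G.Covector) : Prop where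
  og1 : ∀ A : G.Flat, ∃ α ∈ L, α.supp = A
  og2 : ∀ α ∈ L, -α ∈ L
  og3 : ∀ α ∈ L, ∀ β ∈ L, ∃ π ∈ L, Covector.IsProd α β π
  og4 : ∀ α ∈ L, ∀ β ∈ L, ∀ π π' : G.Covector, Covector.IsProd α β π → Covector.IsProd β α π' →
    ∀ x ∈ α.sep β, π.val x ≠ .one →
      ∃ γ ∈ L, γ.val x = .zero ∧
        ∀ y, y ∉ α.sep β → π.val y ≠ .one → γ.val y = π.val y ∧ π.val y = π'.val y

/-- `IsCon X α ν` says that `ν` is the contraction `con_X(α)` of `α`, a covector with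
`supp α = [X ∪ Y] ≤ [X]`, `Y ∈ F/X`: the covector of the contraction by `X` that is supported
by the flat of `Y` and agrees with `α` on the continuations of that flat. -/
def IsCon {G : IntervalGreedoid E} (X : G.FeasibleSet) (α : G.Covector)
    (ν : (G.contract X).Covector) : Prop :=
  ∃ Y : (G.contract X).FeasibleSet, α.supp = G.flatOf ⟨X.1 ∪ Y.1, Y.2.2⟩ ∧
    ν.supp = (G.contract X).flatOf Y ∧ ∀ e ∈ (G.contract X).cont ν.supp, ν.val e = α.val e

/-- The contraction `L/X` of a set of covectors. -/
def contractCovectors [Finite E] {G : IntervalGreedoid E} (L : Set G.Covector)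
    (X : G.FeasibleSet) : Set (G.contract X).Covector :=
  {ν | ∃ α ∈ L, α.supp ≤ G.flatOf X ∧ IsCon X α ν}

/-- The tope poset `T(L, α)`: the topes (maximal elements) of `L`, ordered by inclusion of
their separation sets from `α`. -/
def TopePoset [Finite E] {G : IntervalGreedoid E} (L : Set G.Covector) (_α : L) :=
  {β : L // IsMax β}

instance [Finite E] {G : IntervalGreedoid E} (L : Set G.Covector) (α : L) :
    Preorder (TopePoset L α) where
  le β β' := α.1.sep β.1.1 ⊆ α.1.sep β'.1.1
  le_refl _ := subset_rfl
  le_trans _ _ _ h k := h.trans k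

end IntervalGreedoid

/-- A list enumerates a linear extension of `T`: each element occurs exactly once, and no
element is preceded by one above it. -/
def IsLinearExtension {T : Type*} [Preorder T] (l : List T) : Prop :=
  l.Nodup ∧ (∀ t, t ∈ l) ∧ l.Pairwise fun a b => ¬ b ≤ a

namespace IntervalGreedoid

variable {E : Type*} [DecidableEq E] [Finite E] {G : IntervalGreedoid E}

/-- A maximal chain `β₀ < ⋯ < β_r` of `T(L, α)`, with a choice of a common facet of `β_{i-1}`
and `β_i` for each `i`. -/
structure FacetedChain (L : Set G.Covector) (α : L) where
  r : ℕ
  tope : Fin (r + 1) → TopePoset L α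
  strictMono : StrictMono tope
  isMaxChain : IsMaxChain (· ≤ ·) (Set.range tope)
  facet : Fin r → L
  facet_left : ∀ i, facet i ⋖ (tope i.castSucc).1
  facet_right : ∀ i, facet i ⋖ (tope i.succ).1

/-- The covectors `δ` and `δ'` lie on the same side of the coatom `H` of the lattice of flats:
they have the same sign at an `x ∈ Γ(∅)` that vanishes on `H`, that is, with `H = [{x}]`.
(For `δ`, `δ'` in an oriented interval greedoid this does not depend on `x`.) -/
def SameSide (H : G.Flat) (δ δ' : G.Covector) : Prop :=
  ∃ x ∈ G.cont G.flatEmpty ∩ G.xi H,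
    (δ.val x = .pos ∧ δ'.val x = .pos) ∨ (δ.val x = .neg ∧ δ'.val x = .neg)

/-- The list `m` is a linear extension, adapted to `α`, of the tope poset of the contraction of
`L` to the support of `γᵢ`, based at `γᵢ`. The topes of the contraction are listed as
elements of `L`. -/
def FacetedChain.IsAdapted {L : Set G.Covector} {α : L} (c : FacetedChain L α) (i : Fin c.r)
    (m : List L) : Prop :=
  (∃ X : G.FeasibleSet, G.flatOf X = (c.facet i).1.supp ∧
    ∃ ν : contractCovectors L X, IsCon X (c.facet i).1 ν.1 ∧
      ∃ m' : List (TopePoset (contractCovectors L X) ν), IsLinearExtension m' ∧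
        List.Forall₂ (fun δ τ => IsCon X δ.1 τ.1.1) m m') ∧
  m.Pairwise fun δ δ' =>
    ((∃ j < i, SameSide (c.facet j).1.supp (c.facet i).1 δ'.1) →
      ∃ j < i, SameSide (c.facet j).1.supp (c.facet i).1 δ.1) ∧
    (δ' ⋖ α → δ ⋖ α ∨ ∃ j < i, SameSide (c.facet j).1.supp (c.facet i).1 δ.1)

/-- The list `l` is a linear order on the set of facets of `α` (the coatoms of the interval
below `α`) that is compatible with the chain. -/
structure FacetedChain.IsCompatible {L : Set G.Covector} {α : L} (c : FacetedChain L α)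
    (l : List L) : Prop where
  nodup : l.Nodup
  mem_iff : ∀ δ, δ ∈ l ↔ δ ⋖ α
  supp_le : l.Pairwise fun δ δ' => ∀ i j, δ.1.supp = (c.facet i).1.supp →
    δ'.1.supp = (c.facet j).1.supp → i ≤ j
  adapted : ∀ i, ∃ m, c.IsAdapted i m ∧ ∀ δ δ', [δ, δ'].Sublist l →
    δ.1.supp = (c.facet i).1.supp → δ'.1.supp = (c.facet i).1.supp → [δ, δ'].Sublist m

end IntervalGreedoid

/-! ### Recursive coatom orderings -/

/-- Conditions (i) and (ii) of a recursive coatom ordering `l = q₁, …, q_n` of the interval of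
the elements below `x`, whose coatoms are the elements covered by `x`; `sub i` is the ordering
of the coatoms of the interval below `qᵢ`. For rank `1` they hold for the unique order. -/
inductive RecursiveCoatomOrder {P : Type*} [PartialOrder P] : P → List P → Prop
  | intro (x : P) (l : List P) (nodup : l.Nodup) (mem_iff : ∀ q, q ∈ l ↔ q ⋖ x)
      (sub : Fin l.length → List P)
      (sub_rec : ∀ i, RecursiveCoatomOrder (l.get i) (sub i))
      (sub_first : ∀ i, (sub i).Pairwise fun a b =>
        (∃ j < i, b ≤ l.get j) → ∃ j < i, a ≤ l.get j)
      (below : ∀ i, ∀ y ≤ l.get i, (∃ j < i, y ≤ l.get j) →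
        ∃ c, c ⋖ l.get i ∧ y ≤ c ∧ ∃ k < i, c ≤ l.get k) :
      RecursiveCoatomOrder x l

/-- The interval of the elements below `x` is bounded and graded, and `l` is a recursive coatom
ordering of it. -/
def IsRecursiveCoatomOrdering {P : Type*} [PartialOrder P] (x : P) (l : List P) : Prop :=
  (∃ b, IsLeast (Set.Iic x) b) ∧ Nonempty (GradeMinOrder ℕ (Set.Iic x)) ∧
    RecursiveCoatomOrder x l

/-!
The elements of `L` with a given support `A` are compared through their signs on the
continuations `Γ(A)` only, so all arguments take place inside `L`, among the covectors with support
`A` and below, and contractions enter only in the translation of the hypotheses.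

If `B ≤ A`, an element of `Γ(A)` lies in `Γ(B)` or in `ξ(B)` (`mem_cont_or_mem_xi`), and each
`e ∈ Γ(A)` spans a coatom below `A` (`exists_hyperplane`). By elimination the elements spanning the
same coatom are parallel (`val_eq_of_parallel`), so that two covectors with support `A` are
separated by a set of coatoms of `A`. The central fact is `exists_separating_facet`: if `t ≠ t'`
have the same support and lie above `y`, then `t` has a facet above `y` whose support separates
`t` from `t'`.

For topes listed along a linear extension of the tope poset based at `α`, suppose that `y` lies
below `t` and below an earlier tope. Then `t` is not `y ∘ α`, since in the tope poset `y ∘ α` is the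
least tope above `y`. The facet of `t` above `y` which separates `t` from `y ∘ α` also separates `t`
from `α`, so it lies below an earlier tope. It follows that the facets of `t` below earlier topes
are those with support separating `t` from `α`, and these come first in any order compatible with a
maximal chain from `t` to `-t` passing through `α`.

The facets of a tope `α`, in an order compatible with a chain crossing the facets `γ₁, …, γ_r`,
behave in the same way. For a facet `q` of `α` with the support of `γₖ`, a facet `c` of `q` lies
below an earlier facet of `α` if and only if its support separates `q` from `γₖ`. When it does, the
neighbour of `q` across `c` either is a facet of `α`, and then an earlier one, or differs from `α`
on some coatom of index `j < k`. In the latter case `c` vanishes on that coatom, and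
`exists_separating_facet`, applied to `α` and the product of `c` with the tope from which the chain
crosses `γₖ`, yields a facet of `α` above `c` with smaller index. The two cases share the inductive
step `exists_sub_order`, and the result for facets follows by induction on `α`
(`Gallery.Compatible.recursiveCoatomOrder`).
-/

/-! ### Lists and recursive coatom orderings -/

/-- A finite set has an enumeration along which two functions to `ℕ` increase lexicographically. -/
lemma exists_list_lex {T : Type*} [Finite T] (p : T → Prop) (a b : T → ℕ) :
    ∃ l : List T, l.Nodup ∧ (∀ t, t ∈ l ↔ p t) ∧
      l.Pairwise fun s t => a s < a t ∨ a s = a t ∧ b s ≤ b t := by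
  classical
  let key : T → ℕ ×ₗ ℕ := fun t => toLex (a t, b t)
  have hfin : {t | p t}.Finite := Set.toFinite _
  have : Std.Total fun s t : T => key s ≤ key t := ⟨fun s t => le_total _ _⟩
  have : IsTrans T fun s t : T => key s ≤ key t := ⟨fun s t u h h' => le_trans h h'⟩
  refine ⟨hfin.toFinset.toList.insertionSort fun s t => key s ≤ key t, ?_, fun t => ?_, ?_⟩
  · exact (List.perm_insertionSort _ _).nodup_iff.2 (Finset.nodup_toList _)
  · rw [List.mem_insertionSort, Finset.mem_toList]
    simp
  · exact (List.pairwise_insertionSort (fun s t : T => key s ≤ key t) _).imp fun h =>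
      Prod.Lex.toLex_le_toLex.1 h

lemma pairwise_of_forall₂ {S T : Type*} {R : S → T → Prop} {P : S → S → Prop} {Q : T → T → Prop}
    (h : ∀ a b a' b', R a a' → R b b' → Q a' b' → P a b) {l : List S} {l' : List T}
    (hl : List.Forall₂ R l l') (hQ : l'.Pairwise Q) : l.Pairwise P := by
  induction hl with
  | nil => exact List.Pairwise.nil
  | @cons a a' l l' ha hl ih =>
    rw [List.pairwise_cons] at hQ ⊢
    refine ⟨fun b hb => ?_, ih hQ.2⟩
    obtain ⟨n, hn, rfl⟩ := List.mem_iff_getElem.1 hb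
    have hn' : n < l'.length := hl.length_eq ▸ hn
    exact h _ _ _ _ ha (hl.get hn hn') (hQ.1 _ (List.getElem_mem hn'))

/-- In a list that is pairwise related by `R`, an element `a` with `¬ R q a` other than `q` comes
before `q`. -/
lemma exists_lt_get_eq {T : Type*} {l : List T} {R : T → T → Prop} (hR : l.Pairwise R)
    {i : Fin l.length} {a : T} (ha : a ∈ l) (hne : a ≠ l.get i) (h : ¬ R (l.get i) a) :
    ∃ j < i, l.get j = a := by
  obtain ⟨j, rfl⟩ := List.get_of_mem ha
  refine ⟨j, lt_of_le_of_ne (not_lt.1 fun hij => h (List.pairwise_iff_get.1 hR i j hij)) ?_, rfl⟩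
  rintro rfl
  exact hne rfl

/-- For coatoms that are elements of `P`, the conditions on a recursive coatom ordering of an
interval of `WithTop P` may be checked in `P`. -/
lemma RecursiveCoatomOrder.map_coe_intro {P : Type*} [PartialOrder P] {x : WithTop P} {l : List P}
    (nodup : l.Nodup) (mem_iff : ∀ q, q ∈ l.map WithTop.some ↔ q ⋖ x) (sub : Fin l.length → List P)
    (sub_rec : ∀ i, RecursiveCoatomOrder (l.get i : WithTop P) ((sub i).map WithTop.some))
    (sub_first : ∀ i, (sub i).Pairwise fun a b =>
      (∃ j < i, b ≤ l.get j) → ∃ j < i, a ≤ l.get j)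
    (below : ∀ i, ∀ y ≤ l.get i, (∃ j < i, y ≤ l.get j) →
      ∃ c, c ⋖ l.get i ∧ y ≤ c ∧ ∃ k < i, c ≤ l.get k) :
    RecursiveCoatomOrder x (l.map WithTop.some) := by
  have hlen : (l.map (WithTop.some : P → WithTop P)).length = l.length := List.length_map _
  have hget : ∀ i, (l.map WithTop.some).get i = (l.get (i.cast hlen) : WithTop P) := by simp
  have hex : ∀ (y : P) i, (∃ j < i, (y : WithTop P) ≤ (l.map WithTop.some).get j) ↔
      ∃ j < i.cast hlen, y ≤ l.get j := by
    refine fun y i => ⟨?_, ?_⟩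
    · rintro ⟨j, hj, h⟩
      exact ⟨j.cast hlen, hj, WithTop.coe_le_coe.1 (hget j ▸ h)⟩
    · rintro ⟨j, hj, h⟩
      refine ⟨j.cast hlen.symm, hj, ?_⟩
      rw [hget]
      exact WithTop.coe_le_coe.2 h
  refine .intro _ _ (nodup.map WithTop.coe_injective) mem_iff
    (fun i => (sub (i.cast hlen)).map WithTop.some) (fun i => ?_) (fun i => ?_) fun i y hy hj => ?_
  · rw [hget]
    exact sub_rec _
  · refine List.pairwise_map.2 ((sub_first (i.cast hlen)).imp fun h => ?_)
    rwa [hex, hex]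
  · rw [hget] at hy ⊢
    obtain ⟨y, rfl⟩ := WithTop.ne_top_iff_exists.1 (hy.trans_lt (WithTop.coe_lt_top _)).ne
    rw [hex] at hj
    obtain ⟨c, hc, hyc, hcj⟩ := below _ y (WithTop.coe_le_coe.1 hy) hj
    exact ⟨c, WithTop.coe_covBy_coe.2 hc, WithTop.coe_le_coe.2 hyc, (hex c i).2 hcj⟩

/-- A recursive coatom ordering persists when a new top is adjoined to the poset. -/
lemma RecursiveCoatomOrder.map_coe {P : Type*} [PartialOrder P] {x : P} {l : List P}
    (h : RecursiveCoatomOrder x l) :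
    RecursiveCoatomOrder (x : WithTop P) (l.map WithTop.some) := by
  induction h with
  | intro x l nodup mem_iff sub sub_rec sub_first below ih =>
    refine .map_coe_intro nodup (fun q => ?_) sub ih sub_first below
    rw [List.mem_map]
    constructor
    · rintro ⟨q, hq, rfl⟩
      exact WithTop.coe_covBy_coe.2 ((mem_iff q).1 hq)
    · intro hq
      obtain ⟨q, rfl⟩ := WithTop.ne_top_iff_exists.1 (hq.lt.trans_le le_top).ne
      exact ⟨q, (mem_iff q).2 (WithTop.coe_covBy_coe.1 hq), rfl⟩

lemma coe_covBy_top {P : Type*} [PartialOrder P] {a : P} :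
    (a : WithTop P) ⋖ ⊤ ↔ IsMax a := by
  constructor
  · intro h b hab
    rcases hab.eq_or_lt with rfl | hlt
    · exact le_rfl
    · exact absurd (WithTop.coe_lt_top b) (h.2 (WithTop.coe_lt_coe.2 hlt))
  · refine fun h => ⟨WithTop.coe_lt_top a, fun b hab hb => ?_⟩
    obtain ⟨b, rfl⟩ := WithTop.ne_top_iff_exists.1 hb.ne
    exact (WithTop.coe_lt_coe.1 hab).not_ge (h (WithTop.coe_lt_coe.1 hab).le)

lemma isLeast_and_gradeMinOrder_Iic {P : Type*} [PartialOrder P] {o : P} (ho : ∀ a, o ≤ a)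
    {g : P → ℕ} (hg : StrictMono g) (hcov : ∀ a b, a ⋖ b → g b = g a + 1) (h0 : g o = 0) (x : P) :
    (∃ b, IsLeast (Set.Iic x) b) ∧ Nonempty (GradeMinOrder ℕ (Set.Iic x)) := by
  refine ⟨⟨o, ho x, fun a _ => ho a⟩, ⟨?_⟩⟩
  exact
    { grade := fun a => g a.1
      grade_strictMono := fun a b hab => hg hab
      covBy_grade := fun a b hab => by
        rw [Nat.covBy_iff_add_one_eq, hcov a.1 b.1 ⟨hab.lt, fun c h1 h2 =>
          hab.2 (c := ⟨c, h2.le.trans b.2⟩) h1 h2⟩]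
      isMin_grade := fun a ha => by
        have : a = ⟨o, ho x⟩ := le_antisymm (ha (ho a.1)) (ho a.1)
        rw [this]
        exact fun _ _ => h0.le.trans (Nat.zero_le _) }

namespace IntervalGreedoid

/-! ### Flats, continuations and hyperplanes -/

section Flats

variable {E : Type*} [DecidableEq E] {G : IntervalGreedoid E}

lemma notMem_xi_of_mem_cont {A : G.Flat} {e : E} (h : e ∈ G.cont A) : e ∉ G.xi A := by
  rintro ⟨X, rfl, hX⟩
  exact (mem_cont_flatOf.1 h).1 hX

lemma flatOf_le_of_subset {X Y : G.FeasibleSet} (h : X.1 ⊆ Y.1) : G.flatOf Y ≤ G.flatOf X := by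
  have hu : X.1 ∪ Y.1 \ X.1 = Y.1 := Finset.union_sdiff_of_subset h
  exact flat_le_iff.2 ⟨Y.1 \ X.1, ⟨Finset.disjoint_sdiff, by rw [hu]; exact Y.2⟩,
    flatOf_eq.2 (by simp only [hu])⟩

lemma exists_rep_of_le {B : G.Flat} {X : G.FeasibleSet} (h : B ≤ G.flatOf X) :
    ∃ Y : G.FeasibleSet, X.1 ⊆ Y.1 ∧ G.flatOf Y = B := by
  obtain ⟨Z, hZ, rfl⟩ := flat_le_iff.1 h
  exact ⟨_, Finset.subset_union_left, rfl⟩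

lemma xi_antitone {A B : G.Flat} (h : B ≤ A) : G.xi A ⊆ G.xi B := by
  rintro e ⟨X, rfl, hX⟩
  obtain ⟨Y, hXY, rfl⟩ := exists_rep_of_le h
  exact ⟨Y, rfl, hXY hX⟩

/-- By the interval property, a continuation of `X` that is no continuation of the larger set `Y`
lies in no feasible set containing `Y`: at the step at which it is added it would already have
been possible to add it to `Y`. -/
lemma notMem_of_not_feasible_insert {X Y M : Finset E} {e : E} (hX : G.Feasible X)
    (hY : G.Feasible Y) (hXY : X ⊆ Y) (heX : G.Feasible (insert e X)) (heY : e ∉ Y)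
    (hn : ¬ G.Feasible (insert e Y)) (hM : G.Feasible M) (hYM : Y ⊆ M) : e ∉ M := by
  induction hc : M.card using Nat.strong_induction_on generalizing M with
  | _ n ih =>
    intro heM
    have hlt : Y.card < M.card :=
      Finset.card_lt_card ⟨hYM, fun h => heY (h heM)⟩
    obtain ⟨Z, hZ, hZM, hZc⟩ := G.exists_extension ⟨Y, hY⟩ ⟨M, hM⟩ (M.card - 1)
      (by simp only; omega) (by simp only; omega)
    simp only at hZ hZM hZc
    have hsub : Y ∪ Z ⊆ M := Finset.union_subset hYM hZM
    have heYZ : e ∉ Y ∪ Z := ih (Y ∪ Z).card (by omega) hZ.2 Finset.subset_union_left rfl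
    have hMe : insert e (Y ∪ Z) = M :=
      Finset.eq_of_subset_of_card_le (Finset.insert_subset heM hsub)
        (by rw [Finset.card_insert_of_notMem heYZ]; omega)
    exact hn (G.ig3 X Y (Y ∪ Z) hX hY hZ.2 hXY Finset.subset_union_left e heYZ heX (hMe ▸ hM))

/-- A continuation `e` of `X` is either a continuation of the larger feasible set `Y`, or `Y` can
be exchanged for an equivalent set that contains `X ∪ {e}`. -/
lemma feasible_insert_or_exists_rep {X Y : G.FeasibleSet} {e : E} (hXY : X.1 ⊆ Y.1)
    (heX : e ∉ X.1) (hf : G.Feasible (insert e X.1)) :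
    (e ∉ Y.1 ∧ G.Feasible (insert e Y.1)) ∨
      ∃ N : G.FeasibleSet, insert e X.1 ⊆ N.1 ∧ G.flatOf N = G.flatOf Y := by
  by_cases heY : e ∈ Y.1
  · exact Or.inr ⟨Y, Finset.insert_subset heY hXY, rfl⟩
  by_cases hn : G.Feasible (insert e Y.1)
  · exact Or.inl ⟨heY, hn⟩
  right
  have hout : ∀ M : Finset E, G.Feasible M → Y.1 ⊆ M → e ∉ M := fun M hM h =>
    notMem_of_not_feasible_insert X.2 Y.2 hXY hf heY hn hM h
  have hlt : X.1.card < Y.1.card := by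
    refine Finset.card_lt_card ⟨hXY, fun h => hn ?_⟩
    rwa [← Finset.Subset.antisymm hXY h]
  obtain ⟨Z, hZ, hZY, hZc⟩ := G.exists_extension ⟨insert e X.1, hf⟩ Y Y.1.card
    (by simp only [Finset.card_insert_of_notMem heX]; omega) le_rfl
  simp only at hZ hZY hZc
  set N := insert e X.1 ∪ Z with hN
  have heN : e ∈ N := by simp [hN]
  have hNY : N.erase e ⊆ Y.1 := by
    intro a ha
    simp only [hN, Finset.mem_erase, Finset.mem_union, Finset.mem_insert] at ha
    rcases ha with ⟨hne, (h | h) | h⟩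
    · exact absurd h hne
    · exact hXY h
    · exact hZY h
  have hNc : (N.erase e).card + 1 = Y.1.card := by rw [Finset.card_erase_add_one heN, hZc]
  refine ⟨⟨N, hZ.2⟩, Finset.subset_union_left, flatOf_eq.2 (Set.Subset.antisymm ?_ ?_)⟩
  · rintro V ⟨hVd, hVf⟩
    simp only at hVd hVf
    have hVc := Finset.card_union_of_disjoint hVd
    obtain ⟨U, hU, hUV, hUc⟩ := G.exists_extension Y ⟨N ∪ V, hVf⟩ (N ∪ V).card
      (by omega) le_rfl
    simp only at hUV
    have heU : e ∉ U := fun h => hout _ hU.2 Finset.subset_union_left (Finset.mem_union_right _ h)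
    have hsub : U ⊆ V := by
      intro a ha
      rcases Finset.mem_union.1 (hUV ha) with h | h
      · refine absurd ha (Finset.disjoint_left.1 hU.1 (hNY (Finset.mem_erase.2 ⟨?_, h⟩)))
        rintro rfl
        exact heU ha
      · exact h
    rw [Finset.card_union_of_disjoint hU.1] at hUc
    rw [← Finset.eq_of_subset_of_card_le hsub (by omega)]
    exact hU
  · rintro V ⟨hVd, hVf⟩
    have hVc := Finset.card_union_of_disjoint hVd
    obtain ⟨U, hU, hUV, hUc⟩ := G.exists_extension ⟨N, hZ.2⟩ ⟨Y.1 ∪ V, hVf⟩ (Y.1 ∪ V).card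
      (by simp only; omega) le_rfl
    simp only at hUV hU hUc
    have hsub : U ⊆ V := by
      intro a ha
      rcases Finset.mem_union.1 (hUV ha) with h | h
      · -- otherwise `N ∪ U` contains `Y` and `e`
        exfalso
        have haN : a ∉ N := fun h' => Finset.disjoint_left.1 hU.1 h' ha
        have hY : insert a (N.erase e) = Y.1 :=
          Finset.eq_of_subset_of_card_le (Finset.insert_subset h hNY) (by
            rw [Finset.card_insert_of_notMem (fun h' => haN (Finset.mem_of_mem_erase h'))]
            omega)
        refine hout _ hU.2 ?_ (Finset.mem_union_left _ heN)
        rw [← hY]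
        exact Finset.insert_subset (Finset.mem_union_right _ ha)
          ((Finset.erase_subset _ _).trans Finset.subset_union_left)
      · exact h
    rw [Finset.card_union_of_disjoint hU.1] at hUc
    rw [← Finset.eq_of_subset_of_card_le hsub (by omega)]
    exact hU

lemma mem_cont_or_mem_xi {A B : G.Flat} (h : B ≤ A) {e : E} (he : e ∈ G.cont A) :
    e ∈ G.cont B ∨ e ∈ G.xi B := by
  induction A using Quotient.inductionOn with
  | h X =>
    obtain ⟨Y, hXY, rfl⟩ := exists_rep_of_le h
    obtain ⟨h1, h2⟩ := mem_cont_flatOf.1 he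
    rcases feasible_insert_or_exists_rep hXY h1 h2 with h | ⟨N, hN, hNY⟩
    · exact Or.inl (mem_cont_flatOf.2 h)
    · exact Or.inr ⟨N, hNY, hN (Finset.mem_insert_self _ _)⟩

lemma le_flatOf_insert {X : G.FeasibleSet} {B : G.Flat} {e : E} (h : B ≤ G.flatOf X)
    (heX : e ∉ X.1) (hf : G.Feasible (insert e X.1)) (he : e ∈ G.xi B) :
    B ≤ G.flatOf ⟨insert e X.1, hf⟩ := by
  obtain ⟨Y, hXY, rfl⟩ := exists_rep_of_le h
  rcases feasible_insert_or_exists_rep hXY heX hf with h | ⟨N, hN, hNY⟩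
  · exact absurd he (notMem_xi_of_mem_cont (mem_cont_flatOf.2 h))
  · exact hNY ▸ flatOf_le_of_subset hN

lemma le_flatOf_empty (B : G.Flat) : B ≤ G.flatEmpty := by
  induction B using Quotient.inductionOn with
  | h X => exact flatOf_le_of_subset (Finset.empty_subset _)

lemma le_of_xi_subset {A B : G.Flat} (h : G.xi A ⊆ G.xi B) : B ≤ A := by
  induction A using Quotient.inductionOn with
  | h X =>
    have key : ∀ n (X : G.FeasibleSet), X.1.card = n → (X.1 : Set E) ⊆ G.xi B →
        B ≤ G.flatOf X := by
      intro n
      induction n with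
      | zero =>
        rintro ⟨X, hX⟩ hc -
        obtain rfl := Finset.card_eq_zero.1 hc
        exact le_flatOf_empty B
      | succ n ih =>
        rintro ⟨X, hX⟩ hc hXB
        obtain ⟨x, hx, hf⟩ := G.ig1 X hX (by rintro rfl; simp at hc)
        have hins : insert x (X.erase x) = X := Finset.insert_erase hx
        have h1 := ih ⟨X.erase x, hf⟩ (by simp only at hc ⊢; rw [Finset.card_erase_of_mem hx]; omega)
          (fun a ha => hXB (Finset.mem_of_mem_erase ha))
        have h2 := le_flatOf_insert (e := x) h1 (Finset.notMem_erase _ _) (by simpa [hins] using hX)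
          (hXB hx)
        simpa only [hins] using h2
    exact key _ X rfl fun e he => h ⟨X, rfl, he⟩

lemma quot_contract {X : G.FeasibleSet} (Y : (G.contract X).FeasibleSet) :
    (G.contract X).quot Y.1 = G.quot (X.1 ∪ Y.1) := by
  ext W
  constructor
  · rintro ⟨h1, h2, h3⟩
    exact ⟨Finset.disjoint_union_left.2 ⟨(Finset.disjoint_union_right.1 h2).2, h1⟩,
      by rwa [Finset.union_assoc]⟩
  · rintro ⟨h1, h2⟩
    rw [Finset.disjoint_union_left] at h1
    exact ⟨h1.2, Finset.disjoint_union_right.2 ⟨Y.2.1, h1.1⟩, by rwa [← Finset.union_assoc]⟩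

variable [Finite E]

/-- The common cardinality of the feasible sets in a flat. -/
def corank (A : G.Flat) : ℕ :=
  Quotient.lift (fun X : G.FeasibleSet => X.1.card)
    (fun X Y (h : G.quot X.1 = G.quot Y.1) =>
      le_antisymm (G.card_le_of_quot_eq h.symm) (G.card_le_of_quot_eq h)) A

lemma corank_strictAnti {A B : G.Flat} (h : B < A) : corank A < corank B := by
  induction A using Quotient.inductionOn with
  | h X =>
    obtain ⟨Y, hXY, rfl⟩ := exists_rep_of_le h.le
    refine Finset.card_lt_card ⟨hXY, fun h' => h.ne ?_⟩
    rw [show Y = X from Subtype.ext (Finset.Subset.antisymm h' hXY)]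
    rfl

/-- A continuation `e` of the flat `A` spans a hyperplane of `A`: the largest flat below `A` on
which `e` vanishes. -/
lemma exists_hyperplane {A : G.Flat} {e : E} (he : e ∈ G.cont A) :
    ∃ H : G.Flat, H < A ∧ corank H = corank A + 1 ∧ e ∈ G.xi H ∧
      ∀ B ≤ A, e ∈ G.xi B → B ≤ H := by
  induction A using Quotient.inductionOn with
  | h X =>
    obtain ⟨h1, h2⟩ := mem_cont_flatOf.1 he
    have hle : G.flatOf ⟨insert e X.1, h2⟩ ≤ G.flatOf X :=
      flatOf_le_of_subset (Finset.subset_insert _ _)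
    have hxi : e ∈ G.xi (G.flatOf ⟨insert e X.1, h2⟩) := ⟨_, rfl, Finset.mem_insert_self _ _⟩
    refine ⟨G.flatOf ⟨insert e X.1, h2⟩, lt_of_le_of_ne hle fun h => ?_,
      Finset.card_insert_of_notMem h1, hxi, fun B hB hB' => le_flatOf_insert hB h1 h2 hB'⟩
    rw [h] at hxi
    exact notMem_xi_of_mem_cont he hxi

lemma exists_mem_cont_mem_xi {A B : G.Flat} (h : B < A) : ∃ e ∈ G.cont A, e ∈ G.xi B := by
  induction A using Quotient.inductionOn with
  | h X =>
    have hc := corank_strictAnti h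
    obtain ⟨Y, hXY, rfl⟩ := exists_rep_of_le h.le
    obtain ⟨e, he, hf⟩ := G.ig2 Y.1 X.1 Y.2 X.2 hc
    rw [Finset.mem_sdiff] at he
    exact ⟨e, mem_cont_flatOf.2 ⟨he.2, hf⟩, Y, rfl, he.1⟩

lemma covBy_of_corank {A H : G.Flat} (h : H < A) (hc : corank H = corank A + 1) : H ⋖ A :=
  ⟨h, fun B h1 h2 => by
    have := corank_strictAnti h1
    have := corank_strictAnti h2
    omega⟩

lemma le_of_covBy {A H B : G.Flat} (h : H ⋖ A) {e : E} (he : e ∈ G.cont A) (heH : e ∈ G.xi H)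
    (hB : B ≤ A) (heB : e ∈ G.xi B) : B ≤ H := by
  obtain ⟨K, hK, -, -, hmax⟩ := exists_hyperplane he
  have h1 : H ≤ K := hmax H h.le heH
  rcases h1.eq_or_lt with rfl | h2
  · exact hmax B hB heB
  · exact absurd hK (h.2 h2)

lemma eq_of_covBy {A H K : G.Flat} (hH : H ⋖ A) (hK : K ⋖ A) {e : E} (he : e ∈ G.cont A)
    (heH : e ∈ G.xi H) (heK : e ∈ G.xi K) : H = K :=
  le_antisymm (le_of_covBy hK he heK hH.le heH) (le_of_covBy hH he heH hK.le heK)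

lemma corank_of_covBy {A H : G.Flat} (h : H ⋖ A) : corank H = corank A + 1 := by
  obtain ⟨e, he, heH⟩ := exists_mem_cont_mem_xi h.lt
  obtain ⟨K, hK, hc, heK, -⟩ := exists_hyperplane he
  rw [eq_of_covBy h (covBy_of_corank hK hc) he heH heK, hc]

/-- There is a least flat: the class of the bases, which has no continuations. -/
lemma exists_least_flat (G : IntervalGreedoid E) :
    ∃ O : G.Flat, (∀ A, O ≤ A) ∧ G.cont O = ∅ := by
  have : Nonempty G.FeasibleSet := ⟨⟨∅, G.empty_feasible⟩⟩
  obtain ⟨B, hB⟩ := Finite.exists_max fun X : G.FeasibleSet => X.1.card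
  have hcont : G.cont (G.flatOf B) = ∅ := by
    refine Set.eq_empty_iff_forall_notMem.2 fun e he => ?_
    obtain ⟨h1, h2⟩ := mem_cont_flatOf.1 he
    have := hB ⟨_, h2⟩
    simp only [Finset.card_insert_of_notMem h1] at this
    omega
  refine ⟨G.flatOf B, fun A => le_of_xi_subset ?_, hcont⟩
  rintro e ⟨X, rfl, heX⟩
  obtain ⟨Z, hZ, -, hc⟩ := G.exists_extension X B _ (hB X) le_rfl
  -- a feasible set of maximal size is equivalent to `B`, as nothing can be added to it
  have hq : ∀ Y : G.FeasibleSet, Y.1.card = B.1.card → G.quot Y.1 = {∅} := by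
    refine fun Y hY => Set.eq_singleton_iff_unique_mem.2 ⟨⟨by simp, by simpa using Y.2⟩, ?_⟩
    rintro V ⟨hd, hf⟩
    have := hB ⟨_, hf⟩
    simp only [Finset.card_union_of_disjoint hd] at this
    exact Finset.card_eq_zero.1 (by omega)
  refine ⟨⟨_, hZ.2⟩, flatOf_eq.2 ?_, Finset.mem_union_left _ heX⟩
  rw [hq ⟨_, hZ.2⟩ hc, hq B rfl]

end Flats

/-! ### Covectors with a fixed support -/

section Covectors

variable {E : Type*} [DecidableEq E] {G : IntervalGreedoid E}

namespace Covector

lemma mem_cont_of_val_ne {a : G.Covector} {e : E} (h0 : a.val e ≠ .zero) (h1 : a.val e ≠ .one) :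
    e ∈ G.cont a.supp := by
  by_contra hc
  by_cases hx : e ∈ G.xi a.supp
  · exact h0 (a.val_xi e hx)
  · exact h1 (a.val_else e hc hx)

lemma mem_xi_of_val_eq_zero {a : G.Covector} {e : E} (h : a.val e = .zero) :
    e ∈ G.xi a.supp := by
  by_contra hx
  by_cases hc : e ∈ G.cont a.supp
  · rcases a.val_cont e hc with h' | h' <;> simp [h'] at h
  · simp [a.val_else e hc hx] at h

lemma val_ne_zero_of_mem_cont {a : G.Covector} {e : E} (h : e ∈ G.cont a.supp) :
    a.val e ≠ .zero := by
  rcases a.val_cont e h with h' | h' <;> simp [h']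

lemma val_ne_one_of_mem_cont {a : G.Covector} {e : E} (h : e ∈ G.cont a.supp) :
    a.val e ≠ .one := by
  rcases a.val_cont e h with h' | h' <;> simp [h']

lemma mem_cont_of_val_eq {a b : G.Covector} {e : E} (hb : e ∈ G.cont b.supp)
    (h : a.val e = b.val e) : e ∈ G.cont a.supp :=
  mem_cont_of_val_ne (h ▸ val_ne_zero_of_mem_cont hb) (h ▸ val_ne_one_of_mem_cont hb)

lemma val_eq_of_ne_of_ne {a b c : G.Covector} {e : E} (ha : e ∈ G.cont a.supp)
    (hb : e ∈ G.cont b.supp) (hc : e ∈ G.cont c.supp) (hab : a.val e ≠ b.val e)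
    (hac : a.val e ≠ c.val e) : b.val e = c.val e := by
  rcases a.val_cont e ha with h1 | h1 <;> rcases b.val_cont e hb with h2 | h2 <;>
    rcases c.val_cont e hc with h3 | h3 <;> simp_all

lemma mem_sep_iff {a b : G.Covector} (h : b.supp = a.supp) {e : E} :
    e ∈ a.sep b ↔ e ∈ G.cont a.supp ∧ b.val e ≠ a.val e := by
  constructor
  · rintro (⟨h1, h2⟩ | ⟨h1, h2⟩) <;>
      exact ⟨mem_cont_of_val_ne (by simp [h1]) (by simp [h1]), by simp [h1, h2]⟩
  · rintro ⟨he, hne⟩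
    rcases a.val_cont e he with h1 | h1 <;> rcases b.val_cont e (h ▸ he) with h2 | h2 <;>
      simp_all [sep]

lemma ext_of_cont {a b : G.Covector} (h : b.supp = a.supp)
    (hv : ∀ e ∈ G.cont a.supp, b.val e = a.val e) : b = a := by
  refine Covector.ext h (funext fun e => ?_)
  by_cases h1 : e ∈ G.cont a.supp
  · exact hv e h1
  · by_cases h2 : e ∈ G.xi a.supp
    · rw [a.val_xi e h2, b.val_xi e (h ▸ h2)]
    · rw [a.val_else e h1 h2, b.val_else e (h ▸ h1) (h ▸ h2)]

lemma val_neg_ne {a : G.Covector} {e : E} (he : e ∈ G.cont a.supp) : (-a).val e ≠ a.val e := by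
  change (a.val e).flip ≠ a.val e
  rcases a.val_cont e he with h | h <;> simp [h, CovSign.flip]

end Covector

/-- An inclusion of separating sets for covectors with a common support passes to the
contractions of the covectors. -/
lemma IsCon.sep_subset {X : G.FeasibleSet} {γ a b : G.Covector} {ν σ τ : (G.contract X).Covector}
    (hγ : IsCon X γ ν) (ha : IsCon X a σ) (hb : IsCon X b τ) (haγ : a.supp = γ.supp)
    (hbγ : b.supp = γ.supp) (h : γ.sep b ⊆ γ.sep a) : ν.sep τ ⊆ ν.sep σ := by
  have hsupp : ∀ {p q : G.Covector} {π ρ : (G.contract X).Covector}, IsCon X p π → IsCon X q ρ →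
      p.supp = q.supp → π.supp = ρ.supp := by
    rintro p q π ρ ⟨Y, hY, hπ, -⟩ ⟨Z, hZ, hρ, -⟩ hpq
    rw [hπ, hρ]
    rw [hY, hZ] at hpq
    refine flatOf_eq.2 ?_
    rw [quot_contract, quot_contract]
    exact flatOf_eq.1 hpq
  have hσ := hsupp ha hγ haγ
  have hτ := hsupp hb hγ hbγ
  obtain ⟨-, -, -, hνv⟩ := hγ
  obtain ⟨-, -, -, hσv⟩ := ha
  obtain ⟨-, -, -, hτv⟩ := hb
  intro e he
  have hc := ((Covector.mem_sep_iff hτ).1 he).1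
  have key : e ∈ γ.sep b := by
    rw [Covector.sep, Set.mem_ofPred_eq] at he ⊢
    rwa [← hνv e hc, ← hτv e (hτ.symm ▸ hc)]
  have key' := h key
  rw [Covector.sep, Set.mem_ofPred_eq] at key' ⊢
  rwa [hνv e hc, hσv e (hσ.symm ▸ hc)]

end Covectors

section Oriented

open Covector

variable {E : Type*} [DecidableEq E] [Finite E] {G : IntervalGreedoid E} {L : Set G.Covector}

instance : Finite CovSign :=
  Finite.of_injective (β := Bool × Bool)
    (fun s => match s with
      | .zero => (false, false)
      | .pos => (false, true)
      | .neg => (true, false)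
      | .one => (true, true))
    (by rintro (_ | _ | _ | _) (_ | _ | _ | _) h <;> simp_all)

instance : Finite G.Flat := inferInstanceAs (Finite (Quotient G.flatSetoid))

instance : Finite G.Covector :=
  Finite.of_injective (fun a : G.Covector => (a.supp, a.val)) fun _ _ h =>
    Covector.ext (congrArg Prod.fst h) (congrArg Prod.snd h)

lemma supp_le_of_le {a b : L} (h : a ≤ b) : a.1.supp ≤ b.1.supp := h.1

lemma val_eq_of_le {a b : L} (h : a ≤ b) {e : E} (ha : e ∈ G.cont a.1.supp)
    (hb : e ∈ G.cont b.1.supp) : a.1.val e = b.1.val e := h.2 e ⟨ha, hb⟩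

lemma le_mk {a b : L} (h : a.1.supp ≤ b.1.supp)
    (hv : ∀ e ∈ G.cont a.1.supp, e ∈ G.cont b.1.supp → a.1.val e = b.1.val e) : a ≤ b :=
  ⟨h, fun e he => hv e he.1 he.2⟩

lemma eq_of_le_of_supp_eq {a b : L} (h : a ≤ b) (hs : a.1.supp = b.1.supp) : a = b :=
  Subtype.ext (ext_of_cont hs fun _ he => val_eq_of_le h (hs ▸ he) he)

lemma supp_lt_of_lt {a b : L} (h : a < b) : a.1.supp < b.1.supp :=
  lt_of_le_of_ne (supp_le_of_le h.le) fun hs => h.ne (eq_of_le_of_supp_eq h.le hs)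

lemma covBy_of_supp_covBy {a b : L} (h : a ≤ b) (hs : a.1.supp ⋖ b.1.supp) : a ⋖ b :=
  ⟨lt_of_le_of_ne h fun he => hs.lt.ne (he ▸ rfl), fun _ h1 h2 =>
    hs.2 (supp_lt_of_lt h1) (supp_lt_of_lt h2)⟩

/-- The product `y ∘ t` for `supp y ≤ supp t`. -/
lemma exists_comp (hL : G.IsOriented L) {y t : L} (h : y.1.supp ≤ t.1.supp) :
    ∃ p : L, p.1.supp = t.1.supp ∧ y ≤ p ∧
      (∀ e ∈ G.cont t.1.supp, e ∈ G.cont y.1.supp → p.1.val e = y.1.val e) ∧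
      ∀ e ∈ G.cont t.1.supp, e ∈ G.xi y.1.supp → p.1.val e = t.1.val e := by
  obtain ⟨p, hp, hlub, hv⟩ := hL.og3 y.1 y.2 t.1 t.2
  have hs : p.supp = t.1.supp := hlub.unique <| IsGreatest.isLUB
    ⟨Or.inr rfl, by rintro _ (rfl | rfl); exacts [h, le_rfl]⟩
  rw [hs] at hv
  refine ⟨⟨p, hp⟩, hs, le_mk (hs ▸ h) fun e hy ht => ?_, fun e ht => (hv e ht).1,
    fun e ht hx => (hv e ht).2 fun hc => notMem_xi_of_mem_cont hc hx⟩
  exact ((hv e (hs ▸ ht)).1 hy).symm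

lemma exists_neg (hL : G.IsOriented L) (t : L) :
    ∃ n : L, n.1.supp = t.1.supp ∧ ∀ e ∈ G.cont t.1.supp, n.1.val e ≠ t.1.val e :=
  ⟨⟨-t.1, hL.og2 _ t.2⟩, rfl, fun _ he => val_neg_ne he⟩

/-- Elimination between covectors with the same support: the eliminated covector lies below that
support, as it vanishes wherever the given ones do. -/
lemma exists_elimination (hL : G.IsOriented L) {t s : L} (hs : s.1.supp = t.1.supp) {x : E}
    (hx : x ∈ G.cont t.1.supp) (hne : s.1.val x ≠ t.1.val x) :
    ∃ c : L, c.1.supp ≤ t.1.supp ∧ x ∈ G.xi c.1.supp ∧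
      ∀ e ∈ G.cont t.1.supp, s.1.val e = t.1.val e → c.1.val e = t.1.val e := by
  have hlub : IsLUB {t.1.supp, t.1.supp} t.1.supp := by simp
  have hp : Covector.IsProd t.1 s.1 t.1 :=
    ⟨hs ▸ hlub, fun e he => ⟨fun _ => rfl, fun h => absurd he h⟩⟩
  have hp' : Covector.IsProd s.1 t.1 s.1 :=
    ⟨hs ▸ hlub, fun e he => ⟨fun _ => rfl, fun h => absurd he h⟩⟩
  obtain ⟨c, hc, hcx, hcv⟩ := hL.og4 t.1 t.2 s.1 s.2 t.1 s.1 hp hp' x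
    ((mem_sep_iff hs).2 ⟨hx, hne⟩) (val_ne_one_of_mem_cont hx)
  refine ⟨⟨c, hc⟩, le_of_xi_subset fun e he => ?_, mem_xi_of_val_eq_zero hcx,
    fun e he h => (hcv e (fun h' => ((mem_sep_iff hs).1 h').2 h) (val_ne_one_of_mem_cont he)).1⟩
  have h0 : t.1.val e = .zero := t.1.val_xi e he
  refine mem_xi_of_val_eq_zero ((hcv e (fun h' => ?_) (by simp [h0])).1.trans h0)
  exact notMem_xi_of_mem_cont ((mem_sep_iff hs).1 h').1 he

/-- The continuations of `A` that vanish on a coatom `H` below `A` are parallel: if two covectors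
with support `A` agree at one of them, they agree at all of them. -/
lemma val_eq_of_parallel (hL : G.IsOriented L) {t s : L} (hs : s.1.supp = t.1.supp) {H : G.Flat}
    (hH : H ⋖ t.1.supp) {e e' : E} (he : e ∈ G.cont t.1.supp) (heH : e ∈ G.xi H)
    (he' : e' ∈ G.cont t.1.supp) (heH' : e' ∈ G.xi H) (h : s.1.val e = t.1.val e) :
    s.1.val e' = t.1.val e' := by
  by_contra hne
  obtain ⟨c, hc, hce, hcv⟩ := exists_elimination hL hs he' hne
  have hcH : c.1.supp ≤ H := le_of_covBy hH he' heH' hc hce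
  exact notMem_xi_of_mem_cont (mem_cont_of_val_eq he (hcv e he h)) (xi_antitone hcH heH)

/-- The other tope across a facet `f` of `t`. -/
lemma exists_flip (hL : G.IsOriented L) {f t : L} (h : f ≤ t) :
    ∃ s : L, s.1.supp = t.1.supp ∧ f ≤ s ∧
      (∀ e ∈ G.cont t.1.supp, e ∈ G.cont f.1.supp → s.1.val e = t.1.val e) ∧
      ∀ e ∈ G.cont t.1.supp, e ∈ G.xi f.1.supp → s.1.val e ≠ t.1.val e := by
  obtain ⟨n, hn, hnv⟩ := exists_neg hL t
  obtain ⟨s, hs, hfs, h1, h2⟩ := exists_comp hL (y := f) (t := n) (hn ▸ supp_le_of_le h)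
  rw [hn] at hs h1 h2
  exact ⟨s, hs, hfs, fun e he hf => (h1 e he hf).trans (val_eq_of_le h hf he),
    fun e he hf => by rw [h2 e he hf]; exact hnv e he⟩

/-- Two distinct covectors `t`, `t'` with the same support, both above `y`, are separated by the
support of a facet of `t` that lies above `y`. To find it, replace `t'` by a covector `m` above
`y` such that the set separating it from `t` is minimal, eliminate between `t` and `m`, and
compose the result with a covector whose support is a coatom. -/
theorem exists_separating_facet (hL : G.IsOriented L) {t t' y : L}
    (hs' : t'.1.supp = t.1.supp) (hyt : y ≤ t) (hyt' : y ≤ t') (hne : t' ≠ t) :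
    ∃ f : L, f ≤ t ∧ f.1.supp ⋖ t.1.supp ∧ y ≤ f ∧
      ∃ z ∈ G.cont t.1.supp, z ∈ G.xi f.1.supp ∧ t'.1.val z ≠ t.1.val z := by
  obtain ⟨m, ⟨hms, hmy, hmt, hmsub⟩, hmin⟩ := Set.exists_min_image
    {s : L | s.1.supp = t.1.supp ∧ y ≤ s ∧ s ≠ t ∧ t.1.sep s.1 ⊆ t.1.sep t'.1}
    (fun s => (t.1.sep s.1).ncard) (Set.toFinite _) ⟨t', hs', hyt', hne, subset_rfl⟩
  have hmin' : ∀ s : L, s.1.supp = t.1.supp → y ≤ s → t.1.sep s.1 ⊆ t.1.sep m.1 →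
      ∀ z ∈ t.1.sep m.1, z ∉ t.1.sep s.1 → s = t := by
    intro s hs hys hsub z hz hzs
    by_contra hst
    have hlt : (t.1.sep s.1).ncard < (t.1.sep m.1).ncard :=
      Set.ncard_lt_ncard ⟨hsub, fun h => hzs (h hz)⟩ (Set.toFinite _)
    exact absurd (hmin s ⟨hs, hys, hst, hsub.trans hmsub⟩) (not_le.2 hlt)
  obtain ⟨z, hz, hzne⟩ : ∃ z ∈ G.cont t.1.supp, m.1.val z ≠ t.1.val z := by
    by_contra! h
    exact hmt (Subtype.ext (ext_of_cont hms h))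
  have hzm : z ∈ t.1.sep m.1 := (mem_sep_iff hms).2 ⟨hz, hzne⟩
  obtain ⟨c, hc, hcz, hcv⟩ := exists_elimination hL hms hz hzne
  obtain ⟨H, hHt, hHc, hzH, hHmax⟩ := exists_hyperplane hz
  have hcH : c.1.supp ≤ H := hHmax _ hc hcz
  have hzy : z ∈ G.xi y.1.supp := by
    refine (mem_cont_or_mem_xi (supp_le_of_le hyt) hz).resolve_left fun h => hzne ?_
    rw [← val_eq_of_le hyt h hz, ← val_eq_of_le hmy h (hms ▸ hz)]
  have hyH : y.1.supp ≤ H := hHmax _ (supp_le_of_le hyt) hzy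
  -- `d = y ∘ c` lies above `y`, vanishes at `z` and agrees with `t` wherever `m` does
  obtain ⟨d, hd, hdlub, hdv⟩ := hL.og3 y.1 y.2 c.1 c.2
  have hyd : y.1.supp ≤ d.supp := hdlub.1 (Or.inl rfl)
  have hcd : c.1.supp ≤ d.supp := hdlub.1 (Or.inr rfl)
  have hdH : d.supp ≤ H := hdlub.2 (by rintro _ (rfl | rfl); exacts [hyH, hcH])
  have hdval : ∀ e ∈ G.cont t.1.supp, m.1.val e = t.1.val e →
      e ∈ G.cont d.supp ∧ d.val e = t.1.val e := by
    intro e he hme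
    have hce := hcv e he hme
    have hed : e ∈ G.cont d.supp := (mem_cont_or_mem_xi (hdH.trans hHt.le) he).resolve_right
      fun h => notMem_xi_of_mem_cont (mem_cont_of_val_eq he hce) (xi_antitone hcd h)
    refine ⟨hed, ?_⟩
    by_cases hey : e ∈ G.cont y.1.supp
    · rw [(hdv e hed).1 hey, val_eq_of_le hyt hey he]
    · rw [(hdv e hed).2 hey, hce]
  obtain ⟨h, hh, rfl⟩ := hL.og1 H
  obtain ⟨f, hfs, hdf, hf1, hf2⟩ := exists_comp hL (y := ⟨d, hd⟩) (t := ⟨h, hh⟩) hdH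
  simp only at hfs hf1 hf2
  have hyf : y ≤ f := by
    refine le_mk (hfs ▸ hyH) fun e hey hef => ?_
    have hed : e ∈ G.cont d.supp := by
      refine (mem_cont_or_mem_xi hdH (hfs ▸ hef)).resolve_right fun hx => ?_
      exact notMem_xi_of_mem_cont hey (xi_antitone hyd hx)
    rw [hf1 e (hfs ▸ hef) hed, (hdv e hed).1 hey]
  -- by minimality of `m`, the composition of `f` with `t` is `t`
  obtain ⟨s, hss, hfs', hs1, hs2⟩ := exists_comp hL (y := f) (t := t) (hfs ▸ hHt.le)
  have hsub : t.1.sep s.1 ⊆ t.1.sep m.1 := by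
    intro e he
    obtain ⟨he, hne⟩ := (mem_sep_iff hss).1 he
    refine (mem_sep_iff hms).2 ⟨he, fun hme => hne ?_⟩
    obtain ⟨hed, hde⟩ := hdval e he hme
    rcases mem_cont_or_mem_xi (hfs ▸ hHt.le : f.1.supp ≤ t.1.supp) he with hef | hef
    · rw [hs1 e he hef, hf1 e (hfs ▸ hef) hed, hde]
    · exact hs2 e he hef
  have hst : s = t := hmin' s hss (hyf.trans hfs') hsub z hzm fun h =>
    ((mem_sep_iff hss).1 h).2 (hs2 z hz (hfs ▸ hzH))
  subst hst
  exact ⟨f, hfs', hfs ▸ covBy_of_corank hHt hHc, hyf, z, hz, hfs ▸ hzH,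
    ((mem_sep_iff hs').1 (hmsub hzm)).2⟩

/-- `L` has a least element, whose support is the least flat. -/
lemma exists_least (hL : G.IsOriented L) :
    ∃ o : L, (∀ a, o ≤ a) ∧ ∀ A : G.Flat, o.1.supp ≤ A := by
  obtain ⟨O, hO, hcont⟩ := exists_least_flat G
  obtain ⟨o, ho, rfl⟩ := hL.og1 O
  refine ⟨⟨o, ho⟩, fun a => le_mk (hO _) fun e he => ?_, hO⟩
  simp [hcont] at he

lemma supp_covBy_of_covBy (hL : G.IsOriented L) {a b : L} (h : a ⋖ b) :
    a.1.supp ⋖ b.1.supp := by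
  obtain ⟨e, he, hea⟩ := exists_mem_cont_mem_xi (supp_lt_of_lt h.lt)
  obtain ⟨s, hs, has, -, hsv⟩ := exists_flip hL h.le
  obtain ⟨f, hfb, hfc, haf, -⟩ := exists_separating_facet hL hs h.le has fun hsb =>
    hsv e he hea (hsb ▸ rfl)
  have hlt : f < b := lt_of_le_of_ne hfb fun h => hfc.lt.ne (h ▸ rfl)
  rcases haf.eq_or_lt with rfl | h'
  · exact hfc
  · exact absurd hlt (h.2 h')

lemma isMax_iff (hL : G.IsOriented L) {a : L} : IsMax a ↔ a.1.supp = G.flatEmpty := by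
  constructor
  · intro h
    obtain ⟨t, ht, hts⟩ := hL.og1 G.flatEmpty
    obtain ⟨p, hps, hap, -⟩ := exists_comp hL (y := a) (t := ⟨t, ht⟩) (hts ▸ le_flatOf_empty _)
    exact le_antisymm (le_flatOf_empty _) (hts ▸ hps ▸ supp_le_of_le (h hap))
  · intro h b hab
    exact (eq_of_le_of_supp_eq hab (le_antisymm (supp_le_of_le hab)
      (h ▸ le_flatOf_empty _))).ge

end Oriented

/-! ### Galleries -/

section SepChains

variable {E : Type*} [DecidableEq E] {G : IntervalGreedoid E} {L : Set G.Covector}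

/-- A maximal chain for the order by inclusion of separating sets from `α`. -/
structure IsSepChain (α : L) {r : ℕ} (τ : Fin (r + 1) → L) : Prop where
  supp_eq : ∀ i, (τ i).1.supp = α.1.supp
  ssubset : ∀ i j, i < j → α.1.sep (τ i).1 ⊂ α.1.sep (τ j).1
  exists_eq : ∀ s : L, s.1.supp = α.1.supp →
    (∀ i, α.1.sep s.1 ⊆ α.1.sep (τ i).1 ∨ α.1.sep (τ i).1 ⊆ α.1.sep s.1) → ∃ i, τ i = s

lemma IsSepChain.sep_subset_sep {α : L} {r : ℕ} {τ : Fin (r + 1) → L} (h : IsSepChain α τ)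
    {i j : Fin (r + 1)} (hij : i ≤ j) : α.1.sep (τ i).1 ⊆ α.1.sep (τ j).1 := by
  rcases hij.eq_or_lt with rfl | hlt
  · exact subset_rfl
  · exact (h.ssubset i j hlt).1

lemma IsSepChain.sep_zero {α : L} {r : ℕ} {τ : Fin (r + 1) → L} (h : IsSepChain α τ) :
    α.1.sep (τ 0).1 = ∅ := by
  have hα : α.1.sep α.1 = ∅ := Set.eq_empty_iff_forall_notMem.2 fun e he =>
    ((Covector.mem_sep_iff rfl).1 he).2 rfl
  obtain ⟨i, hi⟩ := h.exists_eq α rfl fun i => Or.inl (by rw [hα]; exact Set.empty_subset _)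
  have := h.sep_subset_sep (Fin.zero_le i)
  rw [hi, hα] at this
  exact Set.subset_empty_iff.1 this

end SepChains

section Galleries

open Covector

variable {E : Type*} [DecidableEq E] [Finite E] {G : IntervalGreedoid E} {L : Set G.Covector}

/-- A minimal gallery from `α` to `-α` among the covectors with the same support `A` as `α`,
recorded by the facets crossed and, for each of them, the covector from which it is crossed. The
supports of the facets run through the coatoms below `A`, and the first `i` of these are the ones
separating `α` from `tope i`. -/
structure Gallery (α : L) where
  r : ℕ
  tope : Fin r → L
  facet : Fin r → L
  tope_supp : ∀ i, (tope i).1.supp = α.1.supp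
  facet_le : ∀ i, facet i ≤ tope i
  facet_covBy : ∀ i, (facet i).1.supp ⋖ α.1.supp
  exists_facet : ∀ H, H ⋖ α.1.supp → ∃ i, (facet i).1.supp = H
  val_ne_iff : ∀ i j, ∀ e ∈ G.cont α.1.supp, e ∈ G.xi (facet j).1.supp →
    ((tope i).1.val e ≠ α.1.val e ↔ j < i)

/-- The orders on the facets of `α` that are compatible with a gallery: by increasing index of
the support, and for a fixed support along a linear extension of the order by inclusion of the
sets separating from the facet in the gallery. -/
structure Gallery.Compatible {α : L} (g : Gallery α) (l : List L) : Prop where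
  nodup : l.Nodup
  mem_iff : ∀ δ, δ ∈ l ↔ δ ⋖ α
  index_le : l.Pairwise fun a b => ∀ i j, a.1.supp = (g.facet i).1.supp →
    b.1.supp = (g.facet j).1.supp → i ≤ j
  not_sep_subset : l.Pairwise fun a b => ∀ i, a.1.supp = (g.facet i).1.supp →
    b.1.supp = (g.facet i).1.supp → ¬ (g.facet i).1.sep b.1 ⊆ (g.facet i).1.sep a.1

/-- Two covectors with a common facet are separated exactly at the zeros of that facet. -/
lemma val_ne_iff_of_common_facet (hL : G.IsOriented L) {t t' f : L}
    (hs : t'.1.supp = t.1.supp) (hf : f ⋖ t) (hf' : f ≤ t') (hne : t' ≠ t) {e : E}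
    (he : e ∈ G.cont t.1.supp) : t'.1.val e ≠ t.1.val e ↔ e ∈ G.xi f.1.supp := by
  have key : ∀ e ∈ G.cont t.1.supp, t'.1.val e ≠ t.1.val e → e ∈ G.xi f.1.supp := by
    intro e he h
    refine (mem_cont_or_mem_xi (supp_le_of_le hf.le) he).resolve_left fun hef => h ?_
    rw [← val_eq_of_le hf.le hef he, ← val_eq_of_le hf' hef (hs ▸ he)]
  refine ⟨key e he, fun hx h => ?_⟩
  refine hne (Subtype.ext (ext_of_cont hs fun z hz => ?_))
  by_contra hzne
  exact hzne (val_eq_of_parallel hL hs (supp_covBy_of_covBy hL hf) he hx hz (key z hz hzne) h)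

/-- If nothing lies strictly between `t` and `t'` in the order by inclusion of separating sets
from `α`, then `t` and `t'` have a common facet. -/
lemma exists_common_facet (hL : G.IsOriented L) {α t t' : L} (ht : t.1.supp = α.1.supp)
    (ht' : t'.1.supp = α.1.supp) (hlt : α.1.sep t.1 ⊂ α.1.sep t'.1)
    (hbtw : ∀ s : L, s.1.supp = α.1.supp → α.1.sep t.1 ⊆ α.1.sep s.1 →
      α.1.sep s.1 ⊆ α.1.sep t'.1 → s = t ∨ s = t') :
    ∃ f : L, f ⋖ t ∧ f ⋖ t' := by
  obtain ⟨o, ho, -⟩ := exists_least hL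
  have hs : t'.1.supp = t.1.supp := ht'.trans ht.symm
  obtain ⟨f, hft, hfc, -, z, hz, hzf, hzne⟩ := exists_separating_facet hL hs (ho t) (ho t')
    (by rintro rfl; exact hlt.ne rfl)
  have hne : ∀ e ∈ G.cont t.1.supp, e ∈ G.xi f.1.supp → t'.1.val e ≠ t.1.val e :=
    fun e he hef h => hzne (val_eq_of_parallel hL hs hfc he hef hz hzf h)
  obtain ⟨s, hss, hfs, hs1, hs2⟩ := exists_flip hL hft
  -- crossing `f` from `t` brings one closer to `t'`
  have hval : ∀ e ∈ G.cont α.1.supp, e ∈ G.xi f.1.supp →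
      t.1.val e = α.1.val e ∧ t'.1.val e ≠ α.1.val e := by
    intro e he hef
    have he' : e ∈ G.cont t.1.supp := ht.symm ▸ he
    have h1 : t.1.val e = α.1.val e := by
      by_contra h
      have h2 := ((mem_sep_iff ht').1 (hlt.1 ((mem_sep_iff ht).2 ⟨he, h⟩))).2
      exact hne e he' hef (val_eq_of_ne_of_ne he (ht' ▸ he) (ht ▸ he) h2.symm (Ne.symm h))
    exact ⟨h1, h1 ▸ hne e he' hef⟩
  have hss' := hss.trans ht
  have h1 : α.1.sep t.1 ⊆ α.1.sep s.1 := fun e he => by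
    obtain ⟨he, h⟩ := (mem_sep_iff ht).1 he
    refine (mem_sep_iff hss').2 ⟨he, ?_⟩
    have he' : e ∈ G.cont t.1.supp := ht.symm ▸ he
    rcases mem_cont_or_mem_xi (supp_le_of_le hft) he' with hef | hef
    · rwa [hs1 e he' hef]
    · exact absurd (hval e he hef).1 h
  have h2 : α.1.sep s.1 ⊆ α.1.sep t'.1 := fun e he => by
    obtain ⟨he, h⟩ := (mem_sep_iff hss').1 he
    have he' : e ∈ G.cont t.1.supp := ht.symm ▸ he
    rcases mem_cont_or_mem_xi (supp_le_of_le hft) he' with hef | hef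
    · rw [hs1 e he' hef] at h
      exact hlt.1 ((mem_sep_iff ht).2 ⟨he, h⟩)
    · exact (mem_sep_iff ht').2 ⟨he, (hval e he hef).2⟩
  rcases hbtw s hss' h1 h2 with rfl | rfl
  · exact absurd rfl (hs2 z hz hzf)
  · exact ⟨f, covBy_of_supp_covBy hft hfc, covBy_of_supp_covBy hfs (hss ▸ hfc)⟩

namespace IsSepChain

variable {α : L} {r : ℕ} {τ : Fin (r + 1) → L}

lemma sep_last (hL : G.IsOriented L) (h : IsSepChain α τ) :
    α.1.sep (τ (Fin.last r)).1 = G.cont α.1.supp := by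
  obtain ⟨n, hn, hnv⟩ := exists_neg hL α
  have hsep : α.1.sep n.1 = G.cont α.1.supp := Set.ext fun e =>
    ⟨fun he => ((mem_sep_iff hn).1 he).1, fun he => (mem_sep_iff hn).2 ⟨he, hnv e he⟩⟩
  have hsub : ∀ i, α.1.sep (τ i).1 ⊆ G.cont α.1.supp := fun i e he =>
    ((mem_sep_iff (h.supp_eq i)).1 he).1
  obtain ⟨i, hi⟩ := h.exists_eq n hn fun i => Or.inr (hsep ▸ hsub i)
  refine (hsub _).antisymm ?_
  rw [← hsep, ← hi]
  exact h.sep_subset_sep (Fin.le_last i)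

lemma exists_facet (hL : G.IsOriented L) (h : IsSepChain α τ) (i : Fin r) :
    ∃ f : L, f ⋖ τ i.castSucc ∧ f ⋖ τ i.succ := by
  refine exists_common_facet hL (h.supp_eq _) (h.supp_eq _)
    (h.ssubset _ _ (Fin.castSucc_lt_succ)) fun s hs h1 h2 => ?_
  obtain ⟨j, rfl⟩ := h.exists_eq s hs fun j => by
    rcases le_or_gt j i.castSucc with hj | hj
    · exact Or.inr ((h.sep_subset_sep hj).trans h1)
    · exact Or.inl (h2.trans (h.sep_subset_sep (Fin.castSucc_lt_iff_succ_le.1 hj)))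
  rcases lt_trichotomy j i.castSucc with hj | rfl | hj
  · exact absurd h1 (h.ssubset _ _ hj).2
  · exact Or.inl rfl
  · rcases (Fin.castSucc_lt_iff_succ_le.1 hj).eq_or_lt with rfl | hj'
    · exact Or.inr rfl
    · exact absurd h2 (h.ssubset _ _ hj').2

variable {facet : Fin r → L}

lemma mem_sep_iff_of_mem_xi (hL : G.IsOriented L) (h : IsSepChain α τ)
    (left : ∀ i, facet i ⋖ τ i.castSucc) (right : ∀ i, facet i ⋖ τ i.succ) (i : Fin r) {e : E}
    (he : e ∈ G.cont α.1.supp) :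
    e ∈ G.xi (facet i).1.supp ↔ e ∉ α.1.sep (τ i.castSucc).1 ∧ e ∈ α.1.sep (τ i.succ).1 := by
  have hs := h.supp_eq i.castSucc
  have hs' := h.supp_eq i.succ
  have hss := h.ssubset _ _ (Fin.castSucc_lt_succ (i := i))
  rw [← val_ne_iff_of_common_facet hL (hs'.trans hs.symm) (left i) (right i).le
    (fun h' => hss.ne (by rw [h'])) (hs.symm ▸ he)]
  constructor
  · intro hne
    by_cases h1 : e ∈ α.1.sep (τ i.castSucc).1
    · refine absurd ?_ hne
      exact val_eq_of_ne_of_ne he (hs' ▸ he) (hs ▸ he) ((mem_sep_iff hs').1 (hss.1 h1)).2.symm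
        ((mem_sep_iff hs).1 h1).2.symm
    · refine ⟨h1, (mem_sep_iff hs').2 ⟨he, ?_⟩⟩
      rw [mem_sep_iff hs] at h1
      rw [← not_not.1 fun h' => h1 ⟨he, h'⟩]
      exact hne
  · rintro ⟨h1, h2⟩ heq
    rw [mem_sep_iff hs] at h1
    exact h1 ⟨he, heq ▸ ((mem_sep_iff hs').1 h2).2⟩

lemma mem_sep_iff_lt (hL : G.IsOriented L) (h : IsSepChain α τ)
    (left : ∀ i, facet i ⋖ τ i.castSucc) (right : ∀ i, facet i ⋖ τ i.succ) (i : Fin (r + 1))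
    (j : Fin r) {e : E} (he : e ∈ G.cont α.1.supp) (hej : e ∈ G.xi (facet j).1.supp) :
    e ∈ α.1.sep (τ i).1 ↔ j.castSucc < i := by
  obtain ⟨h1, h2⟩ := (h.mem_sep_iff_of_mem_xi hL left right j he).1 hej
  constructor
  · intro hi
    by_contra hlt
    exact h1 (h.sep_subset_sep (not_lt.1 hlt) hi)
  · exact fun hi => h.sep_subset_sep (Fin.castSucc_lt_iff_succ_le.1 hi) h2

/-- A maximal chain with a choice of common facets is a gallery. -/
def gallery (hL : G.IsOriented L) (h : IsSepChain α τ)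
    (left : ∀ i, facet i ⋖ τ i.castSucc) (right : ∀ i, facet i ⋖ τ i.succ) : Gallery α where
  r := r
  tope i := τ i.castSucc
  facet := facet
  tope_supp i := h.supp_eq _
  facet_le i := (left i).le
  facet_covBy i := h.supp_eq i.castSucc ▸ supp_covBy_of_covBy hL (left i)
  exists_facet H hH := by
    obtain ⟨e, he, heH⟩ := exists_mem_cont_mem_xi hH.lt
    by_contra! hne
    -- otherwise `e` would never come to separate the members of the chain from `α`
    have key : ∀ i : Fin (r + 1), e ∉ α.1.sep (τ i).1 := by
      intro i
      induction i using Fin.induction with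
      | zero => simp [h.sep_zero]
      | succ i ih =>
        intro hi
        have hxi := (h.mem_sep_iff_of_mem_xi hL left right i he).2 ⟨ih, hi⟩
        exact hne i (eq_of_covBy (h.supp_eq i.castSucc ▸ supp_covBy_of_covBy hL (left i)) hH he
          hxi heH)
    exact key (Fin.last r) (h.sep_last hL ▸ he)
  val_ne_iff i j e he hej := by
    have := h.mem_sep_iff_lt hL left right i.castSucc j he hej
    rw [mem_sep_iff (h.supp_eq _), and_iff_right he, Fin.castSucc_lt_castSucc_iff] at this
    exact this

end IsSepChain

/-- Every covector `t` with the support of `α` lies on a maximal chain. -/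
lemma exists_isSepChain {α t : L} (ht : t.1.supp = α.1.supp) :
    ∃ (r : ℕ) (τ : Fin (r + 1) → L), IsSepChain α τ ∧ ∃ i, τ i = t := by
  classical
  let T := {s : L // s.1.supp = α.1.supp}
  let R : T → T → Prop := fun a b => α.1.sep a.1.1 ⊆ α.1.sep b.1.1
  have hinj : ∀ a b : T, α.1.sep a.1.1 = α.1.sep b.1.1 → a = b := by
    intro a b h
    refine Subtype.ext (Subtype.ext (ext_of_cont (a.2.trans b.2.symm) fun e he => ?_))
    have hea : e ∈ G.cont a.1.1.supp := a.2.symm ▸ b.2 ▸ he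
    have heα : e ∈ G.cont α.1.supp := b.2 ▸ he
    have h1 := Set.ext_iff.1 h e
    rw [mem_sep_iff a.2, mem_sep_iff b.2, and_iff_right heα, and_iff_right heα] at h1
    by_cases h2 : a.1.1.val e = α.1.val e
    · rw [h2, not_not.1 (fun h3 => h1.2 h3 h2)]
    · exact val_eq_of_ne_of_ne heα hea he (Ne.symm h2) (h1.1 h2).symm
  obtain ⟨M, hM, htM⟩ := (IsChain.singleton (r := R) (a := (⟨t, ht⟩ : T))).exists_maxChain
  have htM : (⟨t, ht⟩ : T) ∈ M := htM rfl
  let c : T → ℕ := fun a => (α.1.sep a.1.1).ncard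
  have hcR : ∀ a ∈ M, ∀ b ∈ M, c a ≤ c b → R a b := by
    intro a ha b hb hab
    have : Std.Refl R := ⟨fun _ => subset_rfl⟩
    rcases hM.1.total ha hb with h | h
    · exact h
    · exact (Set.eq_of_subset_of_ncard_le h hab (Set.toFinite _)).ge
  let F : Finset ℕ := (Set.toFinite (c '' M)).toFinset
  have hF : ∀ n, n ∈ F ↔ ∃ a ∈ M, c a = n := by simp [F]
  obtain ⟨r, hr⟩ : ∃ r, F.card = r + 1 :=
    Nat.exists_eq_add_one.2 (Finset.card_pos.2 ⟨_, (hF _).2 ⟨_, htM, rfl⟩⟩)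
  have hex : ∀ i : Fin (r + 1), ∃ a ∈ M, c a = F.orderEmbOfFin hr i := fun i =>
    (hF _).1 (F.orderEmbOfFin_mem hr i)
  choose τ hτM hτ using hex
  have hsurj : ∀ a ∈ M, ∃ i, τ i = a := by
    intro a ha
    have : c a ∈ Set.range (F.orderEmbOfFin hr) := by
      rw [Finset.range_orderEmbOfFin]
      exact (hF _).2 ⟨a, ha, rfl⟩
    obtain ⟨i, hi⟩ := this
    have hc : c (τ i) = c a := (hτ i).trans hi
    exact ⟨i, hinj _ _ ((hcR _ (hτM i) _ ha hc.le).antisymm (hcR _ ha _ (hτM i) hc.ge))⟩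
  refine ⟨r, fun i => (τ i).1, ⟨fun i => (τ i).2, fun i j hij => ?_, fun s hs hcomp => ?_⟩, ?_⟩
  · have hlt : c (τ i) < c (τ j) := by
      rw [hτ, hτ]
      exact (F.orderEmbOfFin hr).strictMono hij
    refine ⟨hcR _ (hτM i) _ (hτM j) hlt.le, fun h => ?_⟩
    exact absurd (Set.ncard_le_ncard h (Set.toFinite _)) (not_le.2 hlt)
  · have hins : IsChain R (insert ⟨s, hs⟩ M) := hM.1.insert fun b hb _ => by
      obtain ⟨i, rfl⟩ := hsurj b hb
      exact hcomp i
    have hmem : (⟨s, hs⟩ : T) ∈ M := by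
      rw [hM.2 hins (Set.subset_insert _ _)]
      exact Set.mem_insert _ _
    obtain ⟨i, hi⟩ := hsurj _ hmem
    exact ⟨i, congrArg Subtype.val hi⟩
  · obtain ⟨i, hi⟩ := hsurj _ htM
    exact ⟨i, congrArg Subtype.val hi⟩

/-- There is a gallery from `α` passing through `t`: it crosses first the coatoms that separate
`α` from `t`. -/
lemma exists_gallery_through (hL : G.IsOriented L) {α t : L} (ht : t.1.supp = α.1.supp) :
    ∃ (g : Gallery α) (k : ℕ), ∀ j, ∀ e ∈ G.cont α.1.supp, e ∈ G.xi (g.facet j).1.supp →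
      (t.1.val e ≠ α.1.val e ↔ j.1 < k) := by
  obtain ⟨r, τ, h, i, rfl⟩ := exists_isSepChain ht
  choose facet left right using h.exists_facet hL
  refine ⟨h.gallery hL left right, i.1, fun j e he hej => ?_⟩
  have := h.mem_sep_iff_lt hL left right i j he hej
  rw [mem_sep_iff ht, and_iff_right he] at this
  exact this

lemma not_sep_subset_of_ncard_le {γ a b : L} (ha : a.1.supp = γ.1.supp) (hb : b.1.supp = γ.1.supp)
    (hne : a ≠ b) (h : (γ.1.sep a.1).ncard ≤ (γ.1.sep b.1).ncard) :
    ¬ γ.1.sep b.1 ⊆ γ.1.sep a.1 := by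
  intro hsub
  have heq : γ.1.sep b.1 = γ.1.sep a.1 := Set.eq_of_subset_of_ncard_le hsub h (Set.toFinite _)
  refine hne (Subtype.ext (ext_of_cont (ha.trans hb.symm) fun e he => ?_))
  have heγ : e ∈ G.cont γ.1.supp := hb ▸ he
  have h1 := Set.ext_iff.1 heq e
  rw [mem_sep_iff ha, mem_sep_iff hb, and_iff_right heγ, and_iff_right heγ] at h1
  by_cases h2 : a.1.val e = γ.1.val e
  · rw [h2, not_not.1 (fun h3 => h1.1 h3 h2)]
  · exact val_eq_of_ne_of_ne heγ (ha.symm ▸ heγ) he (Ne.symm h2) (h1.2 h2).symm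

lemma Gallery.facet_supp_injective {α : L} (g : Gallery α) {i j : Fin g.r}
    (h : (g.facet i).1.supp = (g.facet j).1.supp) : i = j := by
  obtain ⟨e, he, hei⟩ := exists_mem_cont_mem_xi (g.facet_covBy i).lt
  have key : ∀ k, k > i ↔ k > j := fun k =>
    (g.val_ne_iff k i e he hei).symm.trans (g.val_ne_iff k j e he (h ▸ hei))
  exact le_antisymm (not_lt.1 fun h' => lt_irrefl _ ((key i).2 h'))
    (not_lt.1 fun h' => lt_irrefl _ ((key j).1 h'))

lemma Gallery.exists_compatible {α : L} (g : Gallery α) :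
    ∃ l, g.Compatible l := by
  classical
  have hidx : ∀ δ : L, ∃ n : ℕ, ∃ γ : L, ∀ i, δ.1.supp = (g.facet i).1.supp →
      i.1 = n ∧ g.facet i = γ := by
    intro δ
    by_cases h : ∃ i, δ.1.supp = (g.facet i).1.supp
    · obtain ⟨i, hi⟩ := h
      refine ⟨i, g.facet i, fun j hj => ?_⟩
      rw [g.facet_supp_injective (hj.symm.trans hi)]
      exact ⟨rfl, rfl⟩
    · exact ⟨0, δ, fun i hi => absurd ⟨i, hi⟩ h⟩
  choose n γ hnγ using hidx
  obtain ⟨l, hnd, hmem, hl⟩ := exists_list_lex (fun δ : L => δ ⋖ α) n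
    fun δ => ((γ δ).1.sep δ.1).ncard
  refine ⟨l, hnd, hmem, hl.imp fun {a b} h i j hi hj => ?_, ?_⟩
  · rw [Fin.le_def, (hnγ a i hi).1, (hnγ b j hj).1]
    rcases h with h | h
    exacts [h.le, h.1.le]
  · refine (hl.and hnd).imp fun {a b} h i hi hj => ?_
    obtain ⟨h1, h2⟩ := hnγ a i hi
    obtain ⟨h3, h4⟩ := hnγ b i hj
    rw [← h1, ← h2, ← h3, ← h4] at h
    exact not_sep_subset_of_ncard_le hi hj h.2 (h.1.resolve_left (lt_irrefl _)).2

end Galleries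

/-! ### Recursive coatom orderings -/

section Shelling

open Covector

variable {E : Type*} [DecidableEq E] [Finite E] {G : IntervalGreedoid E} {L : Set G.Covector}

/-- The inductive step for a recursive coatom ordering. Suppose that each `q` in the list comes
with a covector `γ` of the same support such that the facets of `q` below an earlier member of the
list are exactly those with support separating `q` from `γ`, and such that every element below `q`
and an earlier member vanishes somewhere between `q` and `γ`. Then the facets of `q` can be
ordered along a gallery from `q` passing through `γ`. -/
lemma exists_sub_order (hL : G.IsOriented L) (l : List L)
    (ih : ∀ q ∈ l, ∀ (g : Gallery q) (s : List L), g.Compatible s → RecursiveCoatomOrder q s)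
    (i : Fin l.length) (γ : L) (hγ : γ.1.supp = (l.get i).1.supp)
    (hbelow : ∀ y ≤ l.get i, (∃ j < i, y ≤ l.get j) →
      ∃ z ∈ G.cont (l.get i).1.supp, z ∈ G.xi y.1.supp ∧ γ.1.val z ≠ (l.get i).1.val z)
    (hfacet : ∀ c, c ⋖ l.get i → ∀ z ∈ G.cont (l.get i).1.supp, z ∈ G.xi c.1.supp →
      γ.1.val z ≠ (l.get i).1.val z → ∃ j < i, c ≤ l.get j) :
    ∃ s : List L, RecursiveCoatomOrder (l.get i) s ∧
      (s.Pairwise fun a b => (∃ j < i, b ≤ l.get j) → ∃ j < i, a ≤ l.get j) ∧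
      ∀ y ≤ l.get i, (∃ j < i, y ≤ l.get j) →
        ∃ c, c ⋖ l.get i ∧ y ≤ c ∧ ∃ j < i, c ≤ l.get j := by
  obtain ⟨g, k, hk⟩ := exists_gallery_through hL hγ
  obtain ⟨s, hs⟩ := g.exists_compatible
  have hq := List.get_mem l i
  generalize l.get i = q at *
  refine ⟨s, ih q hq g s hs, ?_, fun y hyq hy => ?_⟩
  · refine List.Pairwise.imp_of_mem ?_ hs.index_le
    intro a b ha hb hab hbj
    have ha := (hs.mem_iff a).1 ha
    have hb := (hs.mem_iff b).1 hb
    obtain ⟨z, hz, hzb, hzne⟩ := hbelow b hb.le hbj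
    obtain ⟨ja, hja⟩ := g.exists_facet _ (supp_covBy_of_covBy hL ha)
    obtain ⟨jb, hjb⟩ := g.exists_facet _ (supp_covBy_of_covBy hL hb)
    have hjbk := (hk jb z hz (hjb ▸ hzb)).1 hzne
    have hle : ja.1 ≤ jb.1 := hab ja jb hja.symm hjb.symm
    obtain ⟨w, hw, hwa⟩ := exists_mem_cont_mem_xi (supp_covBy_of_covBy hL ha).lt
    exact hfacet a ha w hw hwa ((hk ja w hw (hja ▸ hwa)).2 (by omega))
  · obtain ⟨z, hz, hzy, hzne⟩ := hbelow y hyq hy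
    obtain ⟨p, hp, hyp, -, hpv⟩ := exists_comp hL (y := y) (t := γ) (hγ ▸ supp_le_of_le hyq)
    rw [hγ] at hp hpv
    obtain ⟨c, hcq, hc, hyc, w, hw, hwc, hwne⟩ := exists_separating_facet hL hp hyq hyp
      fun h => hzne (by rw [← hpv z hz hzy, h])
    have hcq := covBy_of_supp_covBy hcq hc
    rw [hpv w hw (xi_antitone (supp_le_of_le hyc) hwc)] at hwne
    exact ⟨c, hcq, hyc, hfacet c hcq w hw hwc hwne⟩

/-- An order on the facets of `α` that is compatible with a gallery is a recursive coatom ordering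
of the interval below `α`. -/
theorem Gallery.Compatible.recursiveCoatomOrder (hL : G.IsOriented L) {α : L} {g : Gallery α}
    {l : List L} (hl : g.Compatible l) : RecursiveCoatomOrder α l := by
  induction α using WellFoundedLT.induction generalizing l with
  | _ α ih =>
  have ih' : ∀ q ∈ l, ∀ (g : Gallery q) (s : List L), g.Compatible s →
      RecursiveCoatomOrder q s := fun q hq g s hs => ih q ((hl.mem_iff q).1 hq).lt hs
  suffices h : ∀ i : Fin l.length, ∃ s : List L, RecursiveCoatomOrder (l.get i) s ∧
      (s.Pairwise fun a b => (∃ j < i, b ≤ l.get j) → ∃ j < i, a ≤ l.get j) ∧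
      ∀ y ≤ l.get i, (∃ j < i, y ≤ l.get j) →
        ∃ c, c ⋖ l.get i ∧ y ≤ c ∧ ∃ j < i, c ≤ l.get j by
    choose s h1 h2 h3 using h
    exact .intro α l hl.nodup hl.mem_iff s h1 h2 h3
  intro i
  have hqα : l.get i ⋖ α := (hl.mem_iff _).1 (List.get_mem l i)
  have hqc := supp_covBy_of_covBy hL hqα
  obtain ⟨k, hk⟩ := g.exists_facet _ hqc
  have hfc := g.facet_covBy k
  -- on the other coatoms, the facet `k` of the gallery differs from `α` for the indices below `k`
  have hsign : ∀ j, ∀ e ∈ G.cont α.1.supp, e ∈ G.cont (l.get i).1.supp →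
      e ∈ G.xi (g.facet j).1.supp → ((g.facet k).1.val e ≠ α.1.val e ↔ j < k) := by
    intro j e he hei hej
    rw [val_eq_of_le (g.facet_le k) (hk ▸ hei) ((g.tope_supp k).symm ▸ he)]
    exact g.val_ne_iff k j e he hej
  refine exists_sub_order hL l ih' i (g.facet k) hk ?_ ?_
  · rintro y hyq ⟨j, hji, hyj⟩
    have hjα : l.get j ⋖ α := (hl.mem_iff _).1 (List.get_mem l j)
    obtain ⟨k', hk'⟩ := g.exists_facet _ (supp_covBy_of_covBy hL hjα)
    have hle : k' ≤ k := List.pairwise_iff_get.1 hl.index_le j i hji k' k hk'.symm hk.symm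
    rcases hle.eq_or_lt with rfl | hlt
    · -- `q` is not the product of `y` and the facet of the gallery, being minimal among such
      have hns := List.pairwise_iff_get.1 hl.not_sep_subset j i hji k' hk'.symm hk.symm
      by_contra! hcon
      refine hns fun z hz => ?_
      obtain ⟨hz, hzne⟩ := (mem_sep_iff hk.symm).1 hz
      refine (mem_sep_iff hk'.symm).2 ⟨hz, ?_⟩
      have hzi : z ∈ G.cont (l.get i).1.supp := hk ▸ hz
      rcases mem_cont_or_mem_xi (supp_le_of_le hyq) hzi with hzy | hzy
      · rwa [← val_eq_of_le hyj hzy (hk' ▸ hz), val_eq_of_le hyq hzy hzi]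
      · exact absurd (hcon z hzi hzy).symm hzne
    · obtain ⟨z, hz, hzk'⟩ := exists_mem_cont_mem_xi (g.facet_covBy k').lt
      have hzi : z ∈ G.cont (l.get i).1.supp := by
        refine (mem_cont_or_mem_xi hqc.le hz).resolve_right fun hx => ?_
        exact hlt.ne (g.facet_supp_injective
          (eq_of_covBy (g.facet_covBy k') hfc hz hzk' (hk ▸ hx)))
      refine ⟨z, hzi, xi_antitone (supp_le_of_le hyj) (hk' ▸ hzk'), ?_⟩
      rw [val_eq_of_le hqα.le hzi hz]
      exact (hsign k' z hz hzi hzk').2 hlt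
  · intro c hcq z hz hzc hzne
    have hcc := supp_covBy_of_covBy hL hcq
    have hpar : ∀ e ∈ G.cont (l.get i).1.supp, e ∈ G.xi c.1.supp →
        (g.facet k).1.val e ≠ (l.get i).1.val e := fun e he hec h =>
      hzne (val_eq_of_parallel hL hk hcc he hec hz hzc h)
    obtain ⟨q', hq's, hcq', hq1, hq2⟩ := exists_flip hL hcq.le
    have hq'ne : q' ≠ l.get i := fun h => hq2 z hz hzc (h ▸ rfl)
    have hq3 : ∀ e ∈ G.cont (l.get i).1.supp, e ∈ G.xi c.1.supp →
        (g.facet k).1.val e = q'.1.val e := fun e he hec =>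
      val_eq_of_ne_of_ne he (hk ▸ he) (hq's ▸ he) (hpar e he hec).symm (hq2 e he hec).symm
    by_cases hall : ∀ e ∈ G.cont α.1.supp, e ∈ G.cont (l.get i).1.supp → q'.1.val e = α.1.val e
    · -- the neighbour `q'` of `q` across `c` is a facet of `α`
      have hq'α : q' ⋖ α := covBy_of_supp_covBy
        (le_mk (hq's ▸ hqc.le) fun e he heα => hall e heα (hq's ▸ he)) (hq's ▸ hqc)
      obtain ⟨j, hji, rfl⟩ := exists_lt_get_eq hl.not_sep_subset ((hl.mem_iff q').2 hq'α) hq'ne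
        fun h => h k hk.symm (hq's.trans hk.symm) fun e he => by
          obtain ⟨he, hne⟩ := (mem_sep_iff (hq's.trans hk.symm)).1 he
          have hei : e ∈ G.cont (l.get i).1.supp := hk ▸ he
          refine (mem_sep_iff hk.symm).2 ⟨he, ?_⟩
          rcases mem_cont_or_mem_xi (supp_le_of_le hcq.le) hei with hec | hec
          · rwa [← hq1 e hei hec]
          · exact (hpar e hei hec).symm
      exact ⟨j, hji, hcq'⟩
    · -- otherwise `c` vanishes on a coatom of smaller index, and `α` has a facet above `c` whose
      -- support separates `α` from the gallery at the time of its `k`-th step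
      push Not at hall
      obtain ⟨e, he, hei, hne⟩ := hall
      have hec : e ∈ G.xi c.1.supp := (mem_cont_or_mem_xi hcc.le hei).resolve_left fun hec =>
        hne (by rw [hq1 e hei hec, val_eq_of_le hqα.le hei he])
      have hcα : c ≤ α := hcq.le.trans hqα.le
      have hts := g.tope_supp k
      have htope : (g.tope k).1.val e ≠ α.1.val e := by
        rw [← val_eq_of_le (g.facet_le k) (hk ▸ hei) (hts.symm ▸ he), hq3 e hei hec]
        exact hne
      obtain ⟨p, hps, hcp, hp1, hp2⟩ := exists_comp hL (y := c) (t := g.tope k)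
        (hts ▸ supp_le_of_le hcα)
      rw [hts] at hps hp1 hp2
      obtain ⟨f, hfα, hfs, hcf, w, hw, hwf, hwne⟩ := exists_separating_facet hL hps hcα hcp
        fun h => htope (by rw [← hp2 e he hec, h])
      have hfα := covBy_of_supp_covBy hfα hfs
      obtain ⟨k', hk'⟩ := g.exists_facet _ hfs
      rw [hp2 w hw (xi_antitone (supp_le_of_le hcf) hwf)] at hwne
      have hlt : k' < k := (g.val_ne_iff k k' w hw (hk' ▸ hwf)).1 hwne
      obtain ⟨j, hji, rfl⟩ := exists_lt_get_eq hl.index_le ((hl.mem_iff f).2 hfα)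
        (fun h => hlt.ne (g.facet_supp_injective (by rw [hk', hk, h])))
        fun h => absurd (h k k' hk.symm hk'.symm) (not_le.2 hlt)
      exact ⟨j, hji, hcf⟩

/-- A linear extension of a tope poset is a recursive coatom ordering of `L` with a new top. -/
theorem recursiveCoatomOrder_top (hL : G.IsOriented L) {α : L} (hα : IsMax α)
    {l : List (TopePoset L α)} (hl : IsLinearExtension l) :
    RecursiveCoatomOrder (⊤ : WithTop L) (l.map fun β => (β.1 : WithTop L)) := by
  obtain ⟨hnd, hmem, hlin⟩ := hl
  set m : List L := l.map fun β => β.1 with hm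
  have hmmem : ∀ t : L, t ∈ m ↔ IsMax t := fun t => by
    rw [hm, List.mem_map]
    exact ⟨by rintro ⟨β, -, rfl⟩; exact β.2, fun h => ⟨⟨t, h⟩, hmem _, rfl⟩⟩
  have hmlin : m.Pairwise fun a b => ¬ α.1.sep b.1 ⊆ α.1.sep a.1 :=
    List.pairwise_map.2 (hlin.imp fun h => h)
  have hsupp : ∀ t ∈ m, t.1.supp = α.1.supp := fun t ht => by
    rw [(isMax_iff hL).1 ((hmmem t).1 ht), (isMax_iff hL).1 hα]
  have h : ∀ i : Fin m.length, ∃ s : List L, RecursiveCoatomOrder (m.get i) s ∧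
      (s.Pairwise fun a b => (∃ j < i, b ≤ m.get j) → ∃ j < i, a ≤ m.get j) ∧
      ∀ y ≤ m.get i, (∃ j < i, y ≤ m.get j) →
        ∃ c, c ⋖ m.get i ∧ y ≤ c ∧ ∃ j < i, c ≤ m.get j := by
    intro i
    have hi := hsupp _ (List.get_mem m i)
    refine exists_sub_order hL m (fun q _ g s hs => hs.recursiveCoatomOrder hL) i α hi.symm ?_ ?_
    · rintro y hyi ⟨j, hji, hyj⟩
      have hj := hsupp _ (List.get_mem m j)
      by_contra! hcon
      refine List.pairwise_iff_get.1 hmlin j i hji fun z hz => ?_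
      obtain ⟨hz, hzne⟩ := (mem_sep_iff hi).1 hz
      refine (mem_sep_iff hj).2 ⟨hz, ?_⟩
      have hzi : z ∈ G.cont (m.get i).1.supp := hi.symm ▸ hz
      rcases mem_cont_or_mem_xi (supp_le_of_le hyi) hzi with hzy | hzy
      · rwa [← val_eq_of_le hyj hzy (hj.symm ▸ hz), val_eq_of_le hyi hzy hzi]
      · exact absurd (hcon z hzi hzy).symm hzne
    · intro c hci z hz hzc hzne
      obtain ⟨t, hts, hct, ht1, ht2⟩ := exists_flip hL hci.le
      have htα := hts.trans hi
      obtain ⟨j, hji, rfl⟩ := exists_lt_get_eq hmlin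
        ((hmmem t).2 ((isMax_iff hL).2 (htα.trans ((isMax_iff hL).1 hα))))
        (fun h => ht2 z hz hzc (h ▸ rfl)) fun h => h fun e he => by
          obtain ⟨he, hne⟩ := (mem_sep_iff htα).1 he
          have hei : e ∈ G.cont (m.get i).1.supp := hi.symm ▸ he
          refine (mem_sep_iff hi).2 ⟨he, ?_⟩
          rcases mem_cont_or_mem_xi (supp_le_of_le hci.le) hei with hec | hec
          · rwa [← ht1 e hei hec]
          · exact fun h => hzne (val_eq_of_parallel hL hi.symm (supp_covBy_of_covBy hL hci)
              hei hec hz hzc h.symm)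
      exact ⟨j, hji, hct⟩
  choose s h1 h2 h3 using h
  have hmap : (l.map fun β => (β.1 : WithTop L)) = m.map WithTop.some := by
    rw [hm, List.map_map]
    rfl
  rw [hmap]
  refine .map_coe_intro (hnd.map fun _ _ => Subtype.ext) (fun q => ?_) s
    (fun i => (h1 i).map_coe) h2 h3
  rw [List.mem_map]
  constructor
  · rintro ⟨q, hq, rfl⟩
    exact coe_covBy_top.2 ((hmmem q).1 hq)
  · intro hq
    obtain ⟨q, rfl⟩ := WithTop.ne_top_iff_exists.1 hq.lt.ne
    exact ⟨q, (hmmem q).2 (coe_covBy_top.1 hq), rfl⟩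

lemma exists_isLinearExtension (hL : G.IsOriented L) {α : L} (hα : IsMax α) :
    ∃ l : List (TopePoset L α), IsLinearExtension l := by
  have : Finite (TopePoset L α) := inferInstanceAs (Finite {β : L // IsMax β})
  have hsupp : ∀ t : TopePoset L α, t.1.1.supp = α.1.supp := fun t => by
    rw [(isMax_iff hL).1 t.2, (isMax_iff hL).1 hα]
  obtain ⟨l, hnd, hmem, hl⟩ := exists_list_lex (fun _ : TopePoset L α => True) (fun _ => 0)
    fun t => (α.1.sep t.1.1).ncard
  refine ⟨l, hnd, fun t => (hmem t).2 trivial, (hl.and hnd).imp fun {s t} h => ?_⟩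
  exact not_sep_subset_of_ncard_le (hsupp s) (hsupp t) (fun h' => h.2 (Subtype.ext h'))
    (h.1.resolve_left (lt_irrefl _)).2

/-! ### Gradedness -/

/-- `L` is graded by the rank of the supports, all maximal elements having the same rank. -/
lemma exists_grade (hL : G.IsOriented L) :
    ∃ (o : L) (g : L → ℕ), (∀ a, o ≤ a) ∧ StrictMono g ∧ (∀ a b, a ⋖ b → g b = g a + 1) ∧
      g o = 0 ∧ ∀ a b, IsMax b → g a ≤ g b := by
  obtain ⟨o, ho, hO⟩ := exists_least hL
  have hle : ∀ {A B : G.Flat}, B ≤ A → corank A ≤ corank B := fun {A B} h => by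
    rcases h.eq_or_lt with rfl | h
    exacts [le_rfl, (corank_strictAnti h).le]
  refine ⟨o, fun a => corank o.1.supp - corank a.1.supp, ho, fun a b hab => ?_, fun a b hab => ?_,
    Nat.sub_self _, fun a b hb => ?_⟩
  · have h1 := corank_strictAnti (supp_lt_of_lt hab)
    have h2 := hle (hO a.1.supp)
    simp only
    omega
  · have h1 := corank_of_covBy (supp_covBy_of_covBy hL hab)
    have h2 := hle (hO a.1.supp)
    simp only
    omega
  · have h1 := hle (le_flatOf_empty a.1.supp)
    rw [← (isMax_iff hL).1 hb] at h1
    exact Nat.sub_le_sub_left h1 _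

lemma isLeast_and_gradeMinOrder_Iic_coe (hL : G.IsOriented L) (α : L) :
    (∃ b, IsLeast (Set.Iic α) b) ∧ Nonempty (GradeMinOrder ℕ (Set.Iic α)) := by
  obtain ⟨o, g, ho, hg, hcov, h0, -⟩ := exists_grade hL
  exact isLeast_and_gradeMinOrder_Iic ho hg hcov h0 α

lemma isLeast_and_gradeMinOrder_Iic_top (hL : G.IsOriented L) {α : L} (hα : IsMax α) :
    (∃ b, IsLeast (Set.Iic (⊤ : WithTop L)) b) ∧
      Nonempty (GradeMinOrder ℕ (Set.Iic (⊤ : WithTop L))) := by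
  obtain ⟨o, g, ho, hg, hcov, h0, hmax⟩ := exists_grade hL
  let g' : WithTop L → ℕ := WithTop.recTopCoe (g α + 1) g
  have htop : g' ⊤ = g α + 1 := rfl
  have hcoe : ∀ a : L, g' a = g a := fun _ => rfl
  refine isLeast_and_gradeMinOrder_Iic (o := (o : WithTop L)) (g := g') (fun a => ?_)
    (fun a b hab => ?_) (fun a b hab => ?_) h0 ⊤
  · induction a using WithTop.recTopCoe with
    | top => exact le_top
    | coe a => exact WithTop.coe_le_coe.2 (ho a)
  · obtain ⟨a, rfl⟩ := WithTop.ne_top_iff_exists.1 hab.ne_top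
    induction b using WithTop.recTopCoe with
    | top => rw [htop, hcoe]; exact Nat.lt_succ_of_le (hmax a α hα)
    | coe b => exact hg (WithTop.coe_lt_coe.1 hab)
  · obtain ⟨a, rfl⟩ := WithTop.ne_top_iff_exists.1 hab.lt.ne_top
    induction b using WithTop.recTopCoe with
    | top =>
      rw [htop, hcoe, (hmax α a (coe_covBy_top.1 hab)).antisymm (hmax a α hα)]
    | coe b => exact hcov a b (WithTop.coe_covBy_coe.1 hab)

/-! ### Maximal chains of the tope poset -/

lemma FacetedChain.isSepChain (hL : G.IsOriented L) {α : L} (hα : IsMax α)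
    (c : FacetedChain L α) : IsSepChain α fun i => (c.tope i).1 where
  supp_eq i := by rw [(isMax_iff hL).1 (c.tope i).2, (isMax_iff hL).1 hα]
  ssubset i j hij := (lt_iff_le_not_ge.1 (c.strictMono hij) :)
  exists_eq s hs hcomp := by
    let t : TopePoset L α := ⟨s, (isMax_iff hL).2 (hs.trans ((isMax_iff hL).1 hα))⟩
    have hins : IsChain (· ≤ ·) (insert t (Set.range c.tope)) :=
      c.isMaxChain.1.insert fun b hb _ => by
        obtain ⟨i, rfl⟩ := hb
        exact hcomp i
    have hmem : t ∈ Set.range c.tope := by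
      rw [c.isMaxChain.2 hins (Set.subset_insert _ _)]
      exact Set.mem_insert _ _
    obtain ⟨i, hi⟩ := hmem
    exact ⟨i, congrArg Subtype.val hi⟩

lemma FacetedChain.IsCompatible.compatible (hL : G.IsOriented L) {α : L} (hα : IsMax α)
    {c : FacetedChain L α} {l : List L} (hl : c.IsCompatible l) :
    ((c.isSepChain hL hα).gallery hL c.facet_left c.facet_right).Compatible l where
  nodup := hl.nodup
  mem_iff := hl.mem_iff
  index_le := hl.supp_le
  not_sep_subset := by
    refine List.pairwise_iff_forall_sublist.2 fun {a b} hab i ha hb => ?_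
    obtain ⟨m, ⟨⟨X, -, ν, hν, m', hm', hmm'⟩, -⟩, hm⟩ := hl.adapted i
    have hpw : m.Pairwise fun a b => a.1.supp = (c.facet i).1.supp →
        b.1.supp = (c.facet i).1.supp →
        ¬ (c.facet i).1.sep b.1 ⊆ (c.facet i).1.sep a.1 :=
      pairwise_of_forall₂ (fun a b a' b' haa' hbb' hn ha hb h =>
        hn (hν.sep_subset haa' hbb' ha hb h)) hmm' hm'.2.2
    exact List.pairwise_iff_forall_sublist.1 hpw (hm a b hab ha hb) ha hb

end Shelling

end IntervalGreedoid

theorem mainTheorem3 {E : Type*} [DecidableEq E] [Finite E] (G : IntervalGreedoid E)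
    (L : Set G.Covector) (hL : G.IsOriented L) :
    (∃ l : List (WithTop L), IsRecursiveCoatomOrdering (⊤ : WithTop L) l) ∧
    (∀ α : L, IsMax α → ∀ l : List (IntervalGreedoid.TopePoset L α), IsLinearExtension l →
      IsRecursiveCoatomOrdering (⊤ : WithTop L) (l.map fun β => (β.1 : WithTop L))) ∧
    (∀ α : L, IsMax α → ∀ c : IntervalGreedoid.FacetedChain L α, ∀ l : List L,
      c.IsCompatible l → IsRecursiveCoatomOrdering α l) := by
  have htop : ∀ α : L, IsMax α → ∀ l : List (IntervalGreedoid.TopePoset L α),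
      IsLinearExtension l →
      IsRecursiveCoatomOrdering (⊤ : WithTop L) (l.map fun β => (β.1 : WithTop L)) :=
    fun α hα l hl =>
      have h := IntervalGreedoid.isLeast_and_gradeMinOrder_Iic_top hL hα
      ⟨h.1, h.2, IntervalGreedoid.recursiveCoatomOrder_top hL hα hl⟩
  refine ⟨?_, htop, fun α hα c l hl => ?_⟩
  · obtain ⟨α, hα, hs⟩ := hL.og1 G.flatEmpty
    have hmax : IsMax (⟨α, hα⟩ : L) := (IntervalGreedoid.isMax_iff hL).2 hs
    obtain ⟨l, hl⟩ := IntervalGreedoid.exists_isLinearExtension hL hmax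
    exact ⟨_, htop _ hmax l hl⟩
  · have h := IntervalGreedoid.isLeast_and_gradeMinOrder_Iic_coe hL α
    exact ⟨h.1, h.2, (hl.compatible hL hα).recursiveCoatomOrder hL⟩
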